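/- Let $\mathscr{V}$ be a complete and cocomplete cartesian closed category, with internal hom $[-,-]$, equipped with a faithful functor $|-| : \mathscr{V} \to \mathsf{Set}$ that is represented by the terminal object $1$; let $\mathcal{S}$ be a set of sorts, and let $\mathbb{N}_{\mathcal{S}}$ be the set of finitely supported functions $J : \mathcal{S} \to \mathbb{N}$. Regard $\mathscr{V}^{\mathcal{S}}$ as a $\mathscr{V}$-category with hom-objects $\prod_{S}[X_S,Y_S]$, and write $X^J = \prod_{S} X_S^{J(S)}$ and $V \otimes X = (V \times X_S)_{S}$ for $X \in \mathscr{V}^{\mathcal{S}}$, $J \in \mathbb{N}_{\mathcal{S}}$, $V \in \mathscr{V}$. *Enriched theories.* A $\mathscr{V}$-enriched $\mathcal{S}$-sorted signature $\Sigma$ is a set of operation symbols $\sigma$, each with a type $(J,S,P) \in \mathbb{N}_{\mathcal{S}} \times \mathcal{S} \times \mathrm{ob}\,\mathscr{V}$. A $\Sigma$-algebra is an object $A \in \mathscr{V}^{\mathcal{S}}$ with a morphism $\sigma^A : P \times A^J \to A_S$ for each $\sigma \in \Sigma$ of type $(J,S,P)$. The $\Sigma$-algebras form a $\mathscr{V}$-category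 $\Sigma\text{-}\mathsf{Alg}$ over $\mathscr{V}^{\mathcal{S}}$, whose hom-object from $A$ to $B$ is the joint equalizer, over all $\sigma$, of the pairs $\mathscr{V}^{\mathcal{S}}(A,B) \to [P \times A^J, P \times B^J] \to [P \times A^J, B_S]$ and $\mathscr{V}^{\mathcal{S}}(A,B) \to [A_S,B_S] \to [P \times A^J, B_S]$. The underlying classical signature $|\Sigma|$ has an operation symbol $\sigma_p$ with input sorts $J$ and output sort $S$ for each $\sigma \in \Sigma$ of type $(J,S,P)$ and each $p \in |P|$; each $\Sigma$-algebra $A$ has an underlying $|\Sigma|$-algebra $|A|$ with the same carrier and with $\sigma_p^{|A|} = \sigma^A(p,-) : A^J \to A_S$. A syntactic $|\Sigma|$-equation $[\vec v \vdash s \doteq t : S]$ is a pair of $|\Sigma|$-terms of the same sort $S$ in the same finite context $\vec v \equiv v_1 : S_1, \ldots, v_n : S_n$; it is satisfied by $|A|$ if the interpretations of $s$ and $t$ are equal as morphisms $A_{S_1} \times \cdots \times A_{S_n} \to A_S$ of $\mathscr{V}$. A $\mathscr{V}$-enriched $\mathcal{S}$-sorted equational theory $\mathcal{T}$ is such a $\Sigma$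 together with a set of syntactic $|\Sigma|$-equations, and $\mathcal{T}\text{-}\mathsf{Alg}$ is the full sub-$\mathscr{V}$-category of $\Sigma\text{-}\mathsf{Alg}$ on the algebras $A$ for which $|A|$ satisfies all of these equations. *Diagrammatic presentations.* A free-form $\mathbb{N}_{\mathcal{S}}$-signature $\mathscr{S}$ is a set of operation symbols $\sigma$, each with an arity $J \in \mathbb{N}_{\mathcal{S}}$ and a parameter $P \in \mathrm{ob}\,\mathscr{V}^{\mathcal{S}}$. An $\mathscr{S}$-algebra is an object $A \in \mathscr{V}^{\mathcal{S}}$ with a morphism $\sigma^A : A^J \otimes P \to A$ of $\mathscr{V}^{\mathcal{S}}$ for each $\sigma \in \mathscr{S}$ of arity $J$ and parameter $P$; a morphism of $\mathscr{S}$-algebras is a morphism of $\mathscr{V}^{\mathcal{S}}$ compatible with these operations; and the $\mathscr{S}$-algebras form a $\mathscr{V}$-category $\mathscr{S}\text{-}\mathsf{Alg}$ over $\mathscr{V}^{\mathcal{S}}$, with hom-objects given by the analogous joint equalizers. A diagrammatic $\mathscr{S}$-equation $\omega \doteq \nu$ is a pair of families of morphisms $\omega_A, \nu_A : A^J \otimes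 P \to A$, each natural in $A \in \mathscr{S}\text{-}\mathsf{Alg}$, with the same $J \in \mathbb{N}_{\mathcal{S}}$ and $P \in \mathrm{ob}\,\mathscr{V}^{\mathcal{S}}$; it is satisfied by $A$ if $\omega_A = \nu_A$. A diagrammatic $\mathbb{N}_{\mathcal{S}}$-presentation $\mathscr{T}$ is such an $\mathscr{S}$ together with a set of diagrammatic $\mathscr{S}$-equations, and $\mathscr{T}\text{-}\mathsf{Alg}$ is the full sub-$\mathscr{V}$-category of $\mathscr{S}\text{-}\mathsf{Alg}$ on the algebras that satisfy all of these equations. Then: 1. For each $\mathscr{V}$-enriched $\mathcal{S}$-sorted signature $\Sigma$ there is a free-form $\mathbb{N}_{\mathcal{S}}$-signature $\mathscr{S}_\Sigma$ with an isomorphism $\Sigma\text{-}\mathsf{Alg} \cong \mathscr{S}_\Sigma\text{-}\mathsf{Alg}$ in the slice category $\mathscr{V}\text{-}\mathsf{CAT}/\mathscr{V}^{\mathcal{S}}$ (that is, strictly inverse $\mathscr{V}$-functors that commute strictly with the forgetful $\mathscr{V}$-functors). 2. For each such $\Sigma$ (with $\mathscr{S}_\Sigma$ and the isomorphism of (1))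 and each syntactic $|\Sigma|$-equation $[\vec v \vdash s \doteq t : S]$, there is a diagrammatic $\mathscr{S}_\Sigma$-equation $\omega_s \doteq \omega_t$ such that, for every $\Sigma$-algebra $A$, the $|\Sigma|$-algebra $|A|$ satisfies $[\vec v \vdash s \doteq t : S]$ if and only if the $\mathscr{S}_\Sigma$-algebra that corresponds to $A$ by (1) satisfies $\omega_s \doteq \omega_t$. 3. For each $\mathscr{V}$-enriched $\mathcal{S}$-sorted equational theory $\mathcal{T}$ there is a diagrammatic $\mathbb{N}_{\mathcal{S}}$-presentation $\mathscr{T}_{\mathcal{T}}$ such that $\mathcal{T}\text{-}\mathsf{Alg} \cong \mathscr{T}_{\mathcal{T}}\text{-}\mathsf{Alg}$ in $\mathscr{V}\text{-}\mathsf{CAT}/\mathscr{V}^{\mathcal{S}}$. -/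

import Mathlib

open CategoryTheory CategoryTheory.Limits MonoidalCategory CartesianMonoidalCategory
open scoped CategoryTheory.MonoidalClosed

universe v w u₁ u₂ u₃

noncomputable section

namespace MultiSorted

/-! ### Generalities on `V`-categories -/

section Generalities

variable {V : Type v} [Category.{w} V] [MonoidalCategory V]

theorem eComp_whisker_middle {D : Type u₂} [Category.{u₃} D] [EnrichedOrdinaryCategory V D]
    (X : D) {Y Y' : D} (g : Y ⟶ Y') (Z : D) :
    eHomWhiskerLeft V X g ▷ (Y' ⟶[V] Z) ≫ eComp V X Y' Z =
      (X ⟶[V] Y) ◁ eHomWhiskerRight V g Z ≫ eComp V X Y Z := by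
  dsimp [eHomWhiskerLeft, eHomWhiskerRight]
  simp only [MonoidalCategory.whiskerLeft_comp_assoc, whisker_assoc_symm,
    triangle_assoc_comp_left_inv_assoc, e_assoc', Category.assoc, comp_whiskerRight_assoc]

theorem eHomWhisker_eId {D : Type u₂} [Category.{u₃} D] [EnrichedOrdinaryCategory V D]
    {X Y : D} (f : X ⟶ Y) :
    eId V X ≫ eHomWhiskerLeft V X f = eId V Y ≫ eHomWhiskerRight V f Y := by
  have h1 : eId V X ≫ eHomWhiskerLeft V X f = eHomEquiv V f := by
    have h := eHomEquiv_comp V (𝟙 X) f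
    rw [Category.id_comp, tensorHom_def_assoc, eHomEquiv_id] at h
    rw [h, eHomWhiskerLeft, rightUnitor_inv_naturality_assoc, unitors_inv_equal]
  have h2 : eId V Y ≫ eHomWhiskerRight V f Y = eHomEquiv V f := by
    have h := eHomEquiv_comp V f (𝟙 Y)
    rw [Category.comp_id, tensorHom_def'_assoc, eHomEquiv_id] at h
    rw [h, eHomWhiskerRight, leftUnitor_inv_naturality_assoc]
  rw [h1, h2]

variable {C : Type u₁} [EnrichedCategory V C]

/-- The `V`-category structure on `T` whose hom-objects are those of `C` between the images
under `f`. -/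
abbrev inducedEnriched {T : Type u₂} (f : T → C) : EnrichedCategory V T where
  Hom A B := (f A ⟶[V] f B)
  id A := eId V (f A)
  comp A B E := eComp V (f A) (f B) (f E)
  id_comp _ _ := e_id_comp V _ _
  comp_id _ _ := e_comp_id V _ _
  assoc _ _ _ _ := e_assoc V _ _ _ _

/-- The full sub-`V`-category of `C` on the objects satisfying `p`. -/
instance fullSubEnriched (p : C → Prop) : EnrichedCategory V {A : C // p A} :=
  inducedEnriched Subtype.val

/-- The inclusion `V`-functor of a full sub-`V`-category. -/
def fullSubInclusion (p : C → Prop) : EnrichedFunctor V {A : C // p A} C where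
  obj := Subtype.val
  map A B := 𝟙 (A.1 ⟶[V] B.1)
  map_id _ := Category.comp_id _
  map_comp A B E := by
    refine (Category.comp_id _).trans (Eq.symm ?_)
    refine (congrArg (fun k => k ≫ eComp V A.1 B.1 E.1) (id_tensorHom_id _ _)).trans ?_
    exact Category.id_comp _

/-- An isomorphism in the slice category `V-CAT / E` from `UC : C → E` to `UD : D → E`:
a pair of strictly inverse `V`-functors, strictly compatible with the `V`-functors to `E`. -/
structure IsoOver {E : Type u₃} [EnrichedCategory V E] {D : Type u₂} [EnrichedCategory V D]
    (UC : EnrichedFunctor V C E) (UD : EnrichedFunctor V D E) where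
  functor : EnrichedFunctor V C D
  inverse : EnrichedFunctor V D C
  functor_comp_inverse : functor.comp V inverse = EnrichedFunctor.id V C
  inverse_comp_functor : inverse.comp V functor = EnrichedFunctor.id V D
  functor_over : functor.comp V UD = UC
  inverse_over : inverse.comp V UC = UD

end Generalities

/-! ### Pairwise equalizers as hom-objects -/

section PairwiseEqualizer

variable {V : Type v} [Category.{w} V] [MonoidalCategory V] [HasLimits V]
variable {C : Type u₁} [EnrichedCategory V C]
variable {D : Type u₂} [Category.{u₃} D] [EnrichedOrdinaryCategory V D]
variable {ι : Type w} (F G : ι → EnrichedFunctor V C D)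

/-- An object of `C` with a family of structure morphisms `F i obj ⟶ G i obj` in `D`. -/
structure StructuredObj where
  obj : C
  str : ∀ i, (F i).obj obj ⟶ (G i).obj obj

namespace StructuredObj

variable {F G}

/-- The family of `C(A, B) ⟶ D(F i A, F i B) ⟶ D(F i A, G i B)`. -/
def homLeft (A B : StructuredObj F G) :
    (A.obj ⟶[V] B.obj) ⟶ ∏ᶜ fun i => ((F i).obj A.obj ⟶[V] (G i).obj B.obj) :=
  Pi.lift fun i => (F i).map A.obj B.obj ≫ eHomWhiskerLeft V ((F i).obj A.obj) (B.str i)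

/-- The family of `C(A, B) ⟶ D(G i A, G i B) ⟶ D(F i A, G i B)`. -/
def homRight (A B : StructuredObj F G) :
    (A.obj ⟶[V] B.obj) ⟶ ∏ᶜ fun i => ((F i).obj A.obj ⟶[V] (G i).obj B.obj) :=
  Pi.lift fun i => (G i).map A.obj B.obj ≫ eHomWhiskerRight V (A.str i) ((G i).obj B.obj)

/-- The pairwise equalizer of the families `homLeft` and `homRight`. -/
def homObj (A B : StructuredObj F G) : V := equalizer (homLeft (V := V) A B) (homRight A B)

/-- The inclusion of the pairwise equalizer. -/
def homι (A B : StructuredObj F G) : homObj (V := V) A B ⟶ (A.obj ⟶[V] B.obj) :=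
  equalizer.ι _ _

instance (A B : StructuredObj F G) : Mono (homι (V := V) A B) := by
  exact equalizer.ι_mono (f := homLeft (V := V) A B)

theorem homι_condition (A B : StructuredObj F G) (i : ι) :
    homι (V := V) A B ≫ (F i).map A.obj B.obj ≫ eHomWhiskerLeft V ((F i).obj A.obj) (B.str i) =
    homι A B ≫ (G i).map A.obj B.obj ≫ eHomWhiskerRight V (A.str i) ((G i).obj B.obj) := by
  have h := equalizer.condition (homLeft (V := V) A B) (homRight A B)
  have h' := congrArg (fun k => k ≫ Pi.π _ i) h
  simp only [homLeft, homRight, Category.assoc, Pi.lift_π] at h'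
  exact h'

theorem id_equalizes (A : StructuredObj F G) :
    eId V A.obj ≫ homLeft (V := V) A A = eId V A.obj ≫ homRight A A := by
  refine Pi.hom_ext _ _ fun i => ?_
  simp only [homLeft, homRight, Category.assoc, Pi.lift_π, EnrichedFunctor.map_id_assoc]
  exact eHomWhisker_eId _

theorem comp_equalizes (A B E : StructuredObj F G) :
    ((homι (V := V) A B ⊗ₘ homι B E) ≫ eComp V A.obj B.obj E.obj) ≫ homLeft A E =
      ((homι A B ⊗ₘ homι B E) ≫ eComp V A.obj B.obj E.obj) ≫ homRight A E := by
  refine Pi.hom_ext _ _ fun i => ?_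
  simp only [homLeft, homRight, Category.assoc, Pi.lift_π, EnrichedFunctor.map_comp_assoc]
  rw [eComp_eHomWhiskerLeft, eComp_eHomWhiskerRight]
  simp only [← id_tensorHom, ← tensorHom_id, tensorHom_comp_tensorHom_assoc, Category.comp_id]
  rw [homι_condition B E i, ← homι_condition A B i]
  have h := eComp_whisker_middle (V := V) ((F i).obj A.obj) (B.str i) ((G i).obj E.obj)
  have h' := congrArg (fun k => ((homι (V := V) A B ≫ (F i).map A.obj B.obj) ⊗ₘ
    (homι B E ≫ (G i).map B.obj E.obj)) ≫ k) h
  simp only [← id_tensorHom, ← tensorHom_id, tensorHom_comp_tensorHom_assoc, Category.comp_id,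
    Category.assoc] at h'
  exact h'.symm

/-- The identity of `A`, as the unique factorization of that of `A.obj`. -/
def homId (A : StructuredObj F G) : 𝟙_ V ⟶ homObj (V := V) A A :=
  equalizer.lift (eId V A.obj) (id_equalizes A)

/-- Composition, as the unique factorization of composition in `C`. -/
def homComp (A B E : StructuredObj F G) :
    homObj (V := V) A B ⊗ homObj B E ⟶ homObj (V := V) A E :=
  equalizer.lift ((homι A B ⊗ₘ homι B E) ≫ eComp V A.obj B.obj E.obj) (comp_equalizes A B E)

theorem homId_ι (A : StructuredObj F G) : homId (V := V) A ≫ homι A A = eId V A.obj :=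
  equalizer.lift_ι _ _

theorem homComp_ι (A B E : StructuredObj F G) : homComp (V := V) A B E ≫ homι A E =
    (homι A B ⊗ₘ homι B E) ≫ eComp V A.obj B.obj E.obj :=
  equalizer.lift_ι _ _

instance : EnrichedCategory V (StructuredObj F G) where
  Hom A B := homObj A B
  id A := homId A
  comp A B E := homComp A B E
  id_comp A B := by
    rw [← cancel_mono (homι A B)]
    simp only [Category.assoc, homComp_ι, Category.id_comp]
    rw [← tensorHom_id, tensorHom_comp_tensorHom_assoc, homId_ι, Category.id_comp,
      tensorHom_def', Category.assoc, ← leftUnitor_inv_naturality_assoc, e_id_comp,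
      Category.comp_id]
  comp_id A B := by
    rw [← cancel_mono (homι A B)]
    simp only [Category.assoc, homComp_ι, Category.id_comp]
    rw [← id_tensorHom, tensorHom_comp_tensorHom_assoc, homId_ι, Category.id_comp,
      MonoidalCategory.tensorHom_def, Category.assoc, ← rightUnitor_inv_naturality_assoc, e_comp_id,
      Category.comp_id]
  assoc A B E K := by
    rw [← cancel_mono (homι A K)]
    simp only [Category.assoc, homComp_ι]
    rw [← tensorHom_id, ← id_tensorHom, tensorHom_comp_tensorHom_assoc,
      tensorHom_comp_tensorHom_assoc, homComp_ι, homComp_ι]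
    simp only [Category.id_comp]
    have h1 : ((homι (V := V) A B ⊗ₘ homι B E) ≫ eComp V A.obj B.obj E.obj) ⊗ₘ homι (V := V) E K =
        ((homι A B ⊗ₘ homι B E) ⊗ₘ homι E K) ≫ eComp V A.obj B.obj E.obj ▷ _ := by
      rw [← tensorHom_id, tensorHom_comp_tensorHom, Category.comp_id]
    have h2 : homι (V := V) A B ⊗ₘ ((homι B E ⊗ₘ homι E K) ≫ eComp V B.obj E.obj K.obj) =
        (homι A B ⊗ₘ (homι B E ⊗ₘ homι E K)) ≫ _ ◁ eComp V B.obj E.obj K.obj := by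
      rw [← id_tensorHom, tensorHom_comp_tensorHom, Category.comp_id]
    rw [h1, h2, Category.assoc, Category.assoc, ← associator_inv_naturality_assoc, e_assoc]

variable (V F G) in
/-- The faithful forgetful `V`-functor, with structural morphisms `homι`. -/
def forget : EnrichedFunctor V (StructuredObj F G) C where
  obj A := A.obj
  map A B := homι A B
  map_id A := homId_ι A
  map_comp A B E := homComp_ι A B E

end StructuredObj

end PairwiseEqualizer

/-! ### `V` and `V^S` as `V`-categories -/

section Powers

variable {V : Type v} [Category.{w} V] [CartesianMonoidalCategory V] [MonoidalClosed V]
variable {C : Type u₁} [EnrichedCategory V C]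

theorem curry_comp {X Y Z A B : V} (f : X ⊗ A ⟶ Y) (g : Y ⊗ B ⟶ Z) :
    (MonoidalClosed.curry f ⊗ₘ MonoidalClosed.curry g) ≫ MonoidalClosed.comp X Y Z =
      MonoidalClosed.curry ((α_ X A B).inv ≫ f ▷ B ≫ g) := by
  rw [MonoidalClosed.comp_eq, ← MonoidalClosed.curry_natural_left,
    MonoidalClosed.compTranspose_eq]
  congr 1
  rw [MonoidalCategory.tensorHom_def, MonoidalCategory.whiskerLeft_comp, Category.assoc,
    associator_inv_naturality_right_assoc, associator_inv_naturality_middle_assoc,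
    whisker_exchange_assoc, ← comp_whiskerRight_assoc,
    MonoidalClosed.whiskerLeft_curry_ihom_ev_app]
  exact congrArg (fun k => _ ≫ _ ≫ k) (MonoidalClosed.whiskerLeft_curry_ihom_ev_app (g := g))

/-- A `V`-functor into `V` from its transposed structural morphisms. -/
def ofAction (F : C → V) (a : ∀ X Y : C, F X ⊗ (X ⟶[V] Y) ⟶ F Y)
    (ha : ∀ X, F X ◁ eId V X ≫ a X X = (ρ_ (F X)).hom)
    (ha' : ∀ X Y Z, F X ◁ eComp V X Y Z ≫ a X Z =
      (α_ _ _ _).inv ≫ a X Y ▷ (Y ⟶[V] Z) ≫ a Y Z) : EnrichedFunctor V C V where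
  obj := F
  map X Y := MonoidalClosed.curry (a X Y)
  map_id X := by
    rw [← MonoidalClosed.curry_natural_left, ha]
    rfl
  map_comp X Y Z := by
    refine Eq.trans ?_ (curry_comp (a X Y) (a Y Z)).symm
    rw [← ha']
    exact (MonoidalClosed.curry_natural_left _ _).symm

theorem whiskerLeft_id_ev (X : V) :
    X ◁ MonoidalClosed.id X ≫ (ihom.ev X).app X = (ρ_ X).hom :=
  MonoidalClosed.whiskerLeft_curry_ihom_ev_app (g := (ρ_ X).hom)

theorem whiskerLeft_comp_ev (X Y Z : V) :
    X ◁ MonoidalClosed.comp X Y Z ≫ (ihom.ev X).app Z =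
      (α_ X ((ihom X).obj Y) ((ihom Y).obj Z)).inv ≫
        (ihom.ev X).app Y ▷ ((ihom Y).obj Z) ≫ (ihom.ev Y).app Z :=
  MonoidalClosed.whiskerLeft_curry_ihom_ev_app (g := (MonoidalClosed.compTranspose X Y Z))

variable [HasLimits V] {S : Type w}

/-- The `V`-category `V^S`, with hom-objects `∏ₛ [X s, Y s]`. -/
instance piEnriched : EnrichedCategory V (S → V) where
  Hom X Y := ∏ᶜ fun s => (ihom (X s)).obj (Y s)
  id X := Pi.lift fun s => eId V (X s)
  comp X Y Z := Pi.lift fun s => (Pi.π _ s ⊗ₘ Pi.π _ s) ≫ eComp V (X s) (Y s) (Z s)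
  id_comp X Y := by
    refine Pi.hom_ext _ _ fun s => ?_
    simp only [Category.assoc, Pi.lift_π, Category.id_comp]
    rw [← tensorHom_id, tensorHom_comp_tensorHom_assoc, Pi.lift_π, Category.id_comp,
      tensorHom_def', Category.assoc, ← leftUnitor_inv_naturality_assoc]
    exact (congrArg (fun k => _ ≫ k) (e_id_comp V (X s) (Y s))).trans (Category.comp_id _)
  comp_id X Y := by
    refine Pi.hom_ext _ _ fun s => ?_
    simp only [Category.assoc, Pi.lift_π, Category.id_comp]
    rw [← id_tensorHom, tensorHom_comp_tensorHom_assoc, Pi.lift_π, Category.id_comp,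
      MonoidalCategory.tensorHom_def, Category.assoc, ← rightUnitor_inv_naturality_assoc]
    exact (congrArg (fun k => _ ≫ k) (e_comp_id V (X s) (Y s))).trans (Category.comp_id _)
  assoc W X Y Z := by
    refine Pi.hom_ext _ _ fun s => ?_
    simp only [Category.assoc, Pi.lift_π]
    rw [← tensorHom_id, ← id_tensorHom, tensorHom_comp_tensorHom_assoc,
      tensorHom_comp_tensorHom_assoc, Pi.lift_π, Pi.lift_π]
    simp only [Category.id_comp]
    set a := Pi.π (fun s => (ihom (W s)).obj (X s)) s
    set b := Pi.π (fun s => (ihom (X s)).obj (Y s)) s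
    set c := Pi.π (fun s => (ihom (Y s)).obj (Z s)) s
    have h1 : ((a ⊗ₘ b) ≫ eComp V (W s) (X s) (Y s)) ⊗ₘ c =
        ((a ⊗ₘ b) ⊗ₘ c) ≫ eComp V (W s) (X s) (Y s) ▷ _ := by
      rw [← tensorHom_id, tensorHom_comp_tensorHom, Category.comp_id]
    have h2 : a ⊗ₘ ((b ⊗ₘ c) ≫ eComp V (X s) (Y s) (Z s)) =
        (a ⊗ₘ (b ⊗ₘ c)) ≫ _ ◁ eComp V (X s) (Y s) (Z s) := by
      rw [← id_tensorHom, tensorHom_comp_tensorHom, Category.comp_id]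
    rw [h1, h2, Category.assoc, Category.assoc, ← associator_inv_naturality_assoc]
    exact congrArg (fun k => _ ≫ k) (e_assoc V (W s) (X s) (Y s) (Z s))

/-- The points of `∏ₛ [X s, Y s]` are the morphisms `X ⟶ Y` of the product category. -/
instance piEnrichedOrdinary : EnrichedOrdinaryCategory V (S → V) where
  toEnrichedCategory := piEnriched
  homEquiv {X Y} :=
    { toFun := fun f => Pi.lift fun s => eHomEquiv V (f s)
      invFun := fun g s => (eHomEquiv V).symm (g ≫ Pi.π (fun s => (ihom (X s)).obj (Y s)) s)
      left_inv := fun f => by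
        funext s
        exact (congrArg (eHomEquiv V).symm (Pi.lift_π (fun s => eHomEquiv V (f s)) s)).trans
          (Equiv.symm_apply_apply _ _)
      right_inv := fun g => by
        refine Pi.hom_ext _ _ fun s => ?_
        exact (Pi.lift_π _ _).trans (Equiv.apply_symm_apply _ _) }
  homEquiv_id X := by
    refine Pi.hom_ext _ _ fun s => ?_
    exact (Pi.lift_π _ _).trans ((eHomEquiv_id V (X s)).trans
      (Pi.lift_π (f := fun s => (ihom (X s)).obj (X s)) (fun s => eId V (X s)) s).symm)
  homEquiv_comp {X Y Z} f g := by
    refine Pi.hom_ext _ _ fun s => ?_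
    refine (Pi.lift_π _ _).trans ((eHomEquiv_comp V (f s) (g s)).trans ?_)
    simp only [Category.assoc]
    refine congrArg (fun k => _ ≫ k) (Eq.symm ?_)
    refine (congrArg (fun k => _ ≫ k) (Pi.lift_π _ _)).trans ?_
    rw [tensorHom_comp_tensorHom_assoc]
    erw [Pi.lift_π, Pi.lift_π]

/-- The projection `V`-functor `V^S → V` at the sort `s`. -/
def projFunctor (s : S) : EnrichedFunctor V (S → V) V where
  obj X := X s
  map X Y := Pi.π (fun s => (ihom (X s)).obj (Y s)) s
  map_id _ := Pi.lift_π _ _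
  map_comp _ _ _ := Pi.lift_π _ _

/-- The `V`-functor into `V^S` with given components. -/
def piFunctor (F : S → EnrichedFunctor V C V) : EnrichedFunctor V C (S → V) where
  obj X := fun s => (F s).obj X
  map X Y := Pi.lift fun s => (F s).map X Y
  map_id X := by
    refine Pi.hom_ext _ _ fun s => ?_
    rw [Category.assoc, Pi.lift_π, EnrichedFunctor.map_id]
    exact (Pi.lift_π (fun s => eId V ((F s).obj X)) s).symm
  map_comp X Y Z := by
    refine Pi.hom_ext _ _ fun s => ?_
    rw [Category.assoc, Pi.lift_π, EnrichedFunctor.map_comp, Category.assoc]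
    refine Eq.symm ((congrArg (fun k => _ ≫ k) (Pi.lift_π _ _)).trans ?_)
    rw [tensorHom_comp_tensorHom_assoc, Pi.lift_π, Pi.lift_π]

/-- The power `X^J`, i.e. the product of `J s` copies of `X s` for all sorts `s`. -/
abbrev pow (X : S → V) (J : S →₀ ℕ) : V := ∏ᶜ fun i : (Σ s, Fin (J s)) => X i.1

/-- The morphism `f^J : X^J ⟶ Y^J`. -/
def powMap {X Y : S → V} (f : X ⟶ Y) (J : S →₀ ℕ) : pow X J ⟶ pow Y J :=
  Pi.lift fun i => Pi.π _ i ≫ f i.1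

/-- The `V`-functor `(-)^J : V^S → V`. -/
def powFunctor (J : S →₀ ℕ) : EnrichedFunctor V (S → V) V :=
  ofAction (fun X => pow X J)
    (fun X Y => Pi.lift fun i =>
      (Pi.π (fun i : (Σ s, Fin (J s)) => X i.1) i ⊗ₘ Pi.π (fun s => (ihom (X s)).obj (Y s)) i.1) ≫
        (ihom.ev (X i.1)).app (Y i.1))
    (fun X => by
      refine Pi.hom_ext _ _ fun i => ?_
      rw [Category.assoc, Pi.lift_π, ← id_tensorHom, tensorHom_comp_tensorHom_assoc]
      have h : eId V X ≫ Pi.π (fun s => (ihom (X s)).obj (X s)) i.1 = MonoidalClosed.id (X i.1) :=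
        Pi.lift_π _ _
      rw [h, Category.id_comp, MonoidalCategory.tensorHom_def, Category.assoc, whiskerLeft_id_ev,
        rightUnitor_naturality])
    (fun X Y Z => by
      refine Pi.hom_ext _ _ fun i => ?_
      simp only [Category.assoc, Pi.lift_π]
      rw [← id_tensorHom, tensorHom_comp_tensorHom_assoc]
      have h : eComp V X Y Z ≫ Pi.π (fun s => (ihom (X s)).obj (Z s)) i.1 =
        (Pi.π (fun s => (ihom (X s)).obj (Y s)) i.1 ⊗ₘ
          Pi.π (fun s => (ihom (Y s)).obj (Z s)) i.1) ≫ MonoidalClosed.comp (X i.1) (Y i.1) (Z i.1) :=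
        Pi.lift_π _ _
      rw [h, Category.id_comp, ← tensorHom_id, tensorHom_comp_tensorHom_assoc, Pi.lift_π,
        Category.id_comp]
      have h1 : ∀ {A B A' B' C' : V} (a : A ⟶ A') (b : B ⟶ B') (c : B' ⟶ C'),
          a ⊗ₘ (b ≫ c) = (a ⊗ₘ b) ≫ A' ◁ c := fun a b c => by
        rw [← id_tensorHom, tensorHom_comp_tensorHom, Category.comp_id]
      have h2 : ∀ {A B A' B' C' : V} (a : A ⟶ A') (b : B ⟶ B') (c : B' ⟶ C'),
          (b ≫ c) ⊗ₘ a = (b ⊗ₘ a) ≫ c ▷ A' := fun a b c => by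
        rw [← tensorHom_id, tensorHom_comp_tensorHom, Category.comp_id]
      rw [h1, h2, Category.assoc, whiskerLeft_comp_ev, Category.assoc,
        associator_inv_naturality_assoc]
      rfl)

/-- The `V`-functor `P × (-) : V → V`. -/
def tensorLeftFunctor (P : V) : EnrichedFunctor V V V :=
  ofAction (fun X => P ⊗ X)
    (fun X Y => (α_ P X ((ihom X).obj Y)).hom ≫ P ◁ (ihom.ev X).app Y)
    (fun X => by
      change (P ⊗ X) ◁ MonoidalClosed.id X ≫ _ = _
      rw [associator_naturality_right_assoc, ← MonoidalCategory.whiskerLeft_comp,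
        whiskerLeft_id_ev, rightUnitor_tensor_hom])
    (fun X Y Z => by
      change (P ⊗ X) ◁ MonoidalClosed.comp X Y Z ≫ _ = (α_ (P ⊗ X) ((ihom X).obj Y)
        ((ihom Y).obj Z)).inv ≫ (_ ▷ ((ihom Y).obj Z)) ≫ _
      rw [associator_naturality_right_assoc, ← MonoidalCategory.whiskerLeft_comp,
        whiskerLeft_comp_ev]
      simp)

/-- The `V`-functor `(-) × Q : V → V`. -/
def tensorRightFunctor (Q : V) : EnrichedFunctor V V V :=
  ofAction (fun X => X ⊗ Q)
    (fun X Y => lift (fst X Q ▷ ((ihom X).obj Y) ≫ (ihom.ev X).app Y)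
      (fst (X ⊗ Q) ((ihom X).obj Y) ≫ snd X Q))
    (fun X => by
      change (X ⊗ Q) ◁ MonoidalClosed.id X ≫ _ = _
      refine CartesianMonoidalCategory.hom_ext _ _ ?_ ?_
      · rw [Category.assoc, lift_fst, whisker_exchange_assoc, whiskerLeft_id_ev,
          rightUnitor_naturality]
      · simp [rightUnitor_hom])
    (fun X Y Z => by
      change (X ⊗ Q) ◁ MonoidalClosed.comp X Y Z ≫ _ = (α_ (X ⊗ Q) ((ihom X).obj Y)
        ((ihom Y).obj Z)).inv ≫ (_ ▷ ((ihom Y).obj Z)) ≫ _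
      refine CartesianMonoidalCategory.hom_ext _ _ ?_ ?_
      · simp only [Category.assoc, lift_fst]
        rw [whisker_exchange_assoc, whiskerLeft_comp_ev, ← comp_whiskerRight_assoc, lift_fst,
          associator_inv_naturality_left_assoc, comp_whiskerRight_assoc]
      · simp)

/-- The tensor `Y ⊗ P` of an object `Y` of `V` and an object `P` of `V^S`, formed pointwise. -/
abbrev tensor (Y : V) (P : S → V) : S → V := fun s => Y ⊗ P s

/-- The morphism `g ⊗ 1_P`. -/
def tensorMap {Y Z : V} (g : Y ⟶ Z) (P : S → V) : tensor Y P ⟶ tensor Z P := fun s => g ▷ P s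

/-- The `V`-functor `(-)^J ⊗ P : V^S → V^S`. -/
def powTensorFunctor (J : S →₀ ℕ) (P : S → V) : EnrichedFunctor V (S → V) (S → V) :=
  (powFunctor J).comp V (piFunctor fun s => tensorRightFunctor (P s))

/-- The `V`-functor `P × (-)^J : V^S → V`. -/
def paramPowFunctor (P : V) (J : S →₀ ℕ) : EnrichedFunctor V (S → V) V :=
  (powFunctor J).comp V (tensorLeftFunctor P)

end Powers

/-! ### Classical signatures, terms and equations -/

/-- A classical `S`-sorted signature: every operation symbol has (finitely many) input sorts and an
output sort. All parameter objects are terminal, and are left out. -/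
structure ClassicalSignature (S : Type w) where
  Op : Type w
  arity : Op → (S →₀ ℕ)
  out : Op → S

/-- A context: a finite set of `S`-sorted variables `v : s`, where the set of variable symbols
of each sort is a copy of `ℕ`. -/
abbrev Context (S : Type w) := Finset (Σ _ : S, ℕ)

namespace ClassicalSignature

variable {S : Type w} (Sg : ClassicalSignature S)

/-- The terms of each sort in the context `Γ`. -/
inductive Term (Γ : Context S) : S → Type w
  | var (x : Γ) : Term Γ x.1.1
  | app (σ : Sg.Op) (t : ∀ i : (Σ s, Fin (Sg.arity σ s)), Term Γ i.1) : Term Γ (Sg.out σ)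

/-- A syntactic equation `[Γ ⊢ lhs ≐ rhs : sort]`. -/
structure Equation where
  ctx : Context S
  sort : S
  lhs : Sg.Term ctx sort
  rhs : Sg.Term ctx sort

section

variable (V : Type v) [Category.{w} V] [HasLimits V]

/-- Algebras in `V^S` for a classical signature. -/
structure Alg where
  carrier : S → V
  op : ∀ σ : Sg.Op, (∏ᶜ fun i : (Σ s, Fin (Sg.arity σ s)) => carrier i.1) ⟶ carrier (Sg.out σ)

end

variable {Sg} {V : Type v} [Category.{w} V] [HasLimits V]

/-- The interpretation of a term in context as a morphism `A s₁ × ... × A sₙ ⟶ A s`. -/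
def Alg.interp (A : Sg.Alg V) {Γ : Context S} :
    {s : S} → Sg.Term Γ s → ((∏ᶜ fun x : Γ => A.carrier x.1.1) ⟶ A.carrier s)
  | _, .var x => Pi.π (fun x : Γ => A.carrier x.1.1) x
  | _, .app σ t => Pi.lift (fun i => A.interp (t i)) ≫ A.op σ

/-- Satisfaction of a syntactic equation. -/
def Alg.Satisfies (A : Sg.Alg V) (e : Sg.Equation) : Prop := A.interp e.lhs = A.interp e.rhs

end ClassicalSignature

/-! ### Enriched signatures and equational theories -/

/-- A `V`-enriched `S`-sorted signature. -/
structure EnrichedSignature (V : Type v) (S : Type w) where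
  Op : Type w
  arity : Op → (S →₀ ℕ)
  out : Op → S
  param : Op → V

namespace EnrichedSignature

variable {V : Type v} [Category.{w} V] [CartesianMonoidalCategory V] [MonoidalClosed V]
  [HasLimits V] {S : Type w}

/-- The algebras for a `V`-enriched signature. -/
structure Alg (Sg : EnrichedSignature V S) where
  carrier : S → V
  op : ∀ σ : Sg.Op, Sg.param σ ⊗ pow carrier (Sg.arity σ) ⟶ carrier (Sg.out σ)

variable {Sg : EnrichedSignature V S}

/-- An algebra as an object of `V^S` with morphisms `P × A^J ⟶ A s`, for the `V`-functors
`P × (-)^J` and evaluation at `s`. -/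
def Alg.toStructuredObj (A : Sg.Alg) :
    StructuredObj (fun σ => paramPowFunctor (Sg.param σ) (Sg.arity σ))
      (fun σ => projFunctor (Sg.out σ)) where
  obj := A.carrier
  str := A.op

/-- The `V`-category of algebras: its hom-objects are the pairwise equalizers of
`V^S(A, B) ⟶ [P × A^J, P × B^J] ⟶ [P × A^J, B s]` and
`V^S(A, B) ⟶ [A s, B s] ⟶ [P × A^J, B s]`. -/
instance : EnrichedCategory V Sg.Alg := inducedEnriched Alg.toStructuredObj

variable (Sg) in
/-- The forgetful `V`-functor to `V^S`. -/
def forget : EnrichedFunctor V Sg.Alg (S → V) where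
  obj A := A.carrier
  map A B := (StructuredObj.forget V _ _).map A.toStructuredObj B.toStructuredObj
  map_id A := (StructuredObj.forget V _ _).map_id A.toStructuredObj
  map_comp A B E := (StructuredObj.forget V _ _).map_comp A.toStructuredObj B.toStructuredObj
    E.toStructuredObj

/-- The underlying classical signature: one operation symbol for every operation symbol `σ` and
every element of the underlying set of the parameter object of `σ`. -/
def underlying (Sg : EnrichedSignature V S) (U : V ⥤ Type w) : ClassicalSignature S where
  Op := Σ σ : Sg.Op, U.obj (Sg.param σ)
  arity σ := Sg.arity σ.1
  out σ := Sg.out σ.1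

/-- The underlying classical algebra: the operation at `(σ, p)` is `σ (p, -)`, where the
element `p` of `|P|` is identified with a morphism `1 ⟶ P`. -/
def Alg.underlying (A : Sg.Alg) {U : V ⥤ Type w} (hU : U.CorepresentableBy (𝟙_ V)) :
    (Sg.underlying U).Alg V where
  carrier := A.carrier
  op σ := lift (toUnit _ ≫ hU.homEquiv.symm σ.2) (𝟙 (pow A.carrier (Sg.arity σ.1))) ≫ A.op σ.1

end EnrichedSignature

/-- A `V`-enriched `S`-sorted equational theory, where `U` gives the underlying sets of the
objects of `V`. -/
structure EquationalTheory {V : Type v} [Category.{w} V] [CartesianMonoidalCategory V]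
    [MonoidalClosed V] [HasLimits V] (U : V ⥤ Type w) (S : Type w) where
  sig : EnrichedSignature V S
  eqs : Set (sig.underlying U).Equation

namespace EquationalTheory

variable {V : Type v} [Category.{w} V] [CartesianMonoidalCategory V] [MonoidalClosed V]
  [HasLimits V] {U : V ⥤ Type w} {S : Type w}

/-- The algebras for the signature that satisfy all the equations, as a full sub-`V`-category. -/
abbrev Alg (T : EquationalTheory U S) (hU : U.CorepresentableBy (𝟙_ V)) :=
  {A : T.sig.Alg // ∀ e ∈ T.eqs, (A.underlying hU).Satisfies e}

/-- The forgetful `V`-functor to `V^S`. -/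
def forget (T : EquationalTheory U S) (hU : U.CorepresentableBy (𝟙_ V)) :
    EnrichedFunctor V (T.Alg hU) (S → V) :=
  (fullSubInclusion _).comp V T.sig.forget

end EquationalTheory

/-! ### Free-form signatures and diagrammatic presentations -/

/-- A free-form signature: its parameter objects are objects of `V^S`. -/
structure FreeFormSignature (V : Type v) (S : Type w) where
  Op : Type w
  arity : Op → (S →₀ ℕ)
  param : Op → (S → V)

namespace FreeFormSignature

variable {V : Type v} [Category.{w} V] [CartesianMonoidalCategory V] [MonoidalClosed V]
  [HasLimits V] {S : Type w}

/-- The algebras for a free-form signature. -/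
structure Alg (Sg : FreeFormSignature V S) where
  carrier : S → V
  op : ∀ σ : Sg.Op, tensor (pow carrier (Sg.arity σ)) (Sg.param σ) ⟶ carrier

variable {Sg : FreeFormSignature V S}

/-- An algebra as an object of `V^S` with morphisms `A^J ⊗ P ⟶ A`, for the `V`-functors
`(-)^J ⊗ P` and the identity. -/
def Alg.toStructuredObj (A : Sg.Alg) :
    StructuredObj (fun σ => powTensorFunctor (Sg.arity σ) (Sg.param σ))
      (fun _ => EnrichedFunctor.id V (S → V)) where
  obj := A.carrier
  str := A.op

/-- The `V`-category of algebras: its hom-objects are the pairwise equalizers of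
`V^S(A, B) ⟶ V^S(A^J ⊗ P, B^J ⊗ P) ⟶ V^S(A^J ⊗ P, B)` and `V^S(A, B) ⟶ V^S(A^J ⊗ P, B)`. -/
instance : EnrichedCategory V Sg.Alg := inducedEnriched Alg.toStructuredObj

variable (Sg) in
/-- The forgetful `V`-functor to `V^S`. -/
def forget : EnrichedFunctor V Sg.Alg (S → V) where
  obj A := A.carrier
  map A B := (StructuredObj.forget V _ _).map A.toStructuredObj B.toStructuredObj
  map_id A := (StructuredObj.forget V _ _).map_id A.toStructuredObj
  map_comp A B E := (StructuredObj.forget V _ _).map_comp A.toStructuredObj B.toStructuredObj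
    E.toStructuredObj

/-- Morphisms of algebras in the ordinary sense. -/
structure Alg.Hom (A B : Sg.Alg) where
  hom : A.carrier ⟶ B.carrier
  comm : ∀ σ : Sg.Op,
    tensorMap (powMap hom (Sg.arity σ)) (Sg.param σ) ≫ B.op σ = A.op σ ≫ hom

variable (Sg) in
/-- A natural operation with arity `J` and parameter `P`. -/
structure NaturalOperation (J : S →₀ ℕ) (P : S → V) where
  app : ∀ A : Sg.Alg, tensor (pow A.carrier J) P ⟶ A.carrier
  naturality : ∀ {A B : Sg.Alg} (f : A.Hom B),
    tensorMap (powMap f.hom J) P ≫ app B = app A ≫ f.hom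

variable (Sg) in
/-- A diagrammatic equation: a pair of natural operations with the same arity and parameter. -/
structure DiagrammaticEquation where
  arity : S →₀ ℕ
  param : S → V
  lhs : Sg.NaturalOperation arity param
  rhs : Sg.NaturalOperation arity param

/-- Satisfaction of a diagrammatic equation. -/
def Alg.Satisfies (A : Sg.Alg) (e : Sg.DiagrammaticEquation) : Prop := e.lhs.app A = e.rhs.app A

end FreeFormSignature

/-- A diagrammatic presentation: a free-form signature with a (small) set of diagrammatic
equations. -/
structure DiagrammaticPresentation (V : Type v) [Category.{w} V] [CartesianMonoidalCategory V]
    [MonoidalClosed V] [HasLimits V] (S : Type w) where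
  sig : FreeFormSignature V S
  eqs : Set sig.DiagrammaticEquation
  small : Small.{w} eqs

namespace DiagrammaticPresentation

variable {V : Type v} [Category.{w} V] [CartesianMonoidalCategory V] [MonoidalClosed V]
  [HasLimits V] {S : Type w}

/-- The algebras for the signature that satisfy all the equations, as a full sub-`V`-category. -/
abbrev Alg (T : DiagrammaticPresentation V S) := {A : T.sig.Alg // ∀ e ∈ T.eqs, A.Satisfies e}

/-- The forgetful `V`-functor to `V^S`. -/
def forget (T : DiagrammaticPresentation V S) : EnrichedFunctor V T.Alg (S → V) :=
  (fullSubInclusion _).comp V T.sig.forget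

end DiagrammaticPresentation

end MultiSorted

end

/-! An operation `P × A^J ⟶ A s` has one output sort, whereas a free-form operation `A^J ⊗ Q ⟶ A`
has a component in every sort. Take `Q = single s P`, which is `P` at `s` and initial elsewhere.
Since `V` is cartesian closed, `Y × -` preserves coproducts, so `Y ⊗ single s P` is initial at every
sort other than `s`, and `strOf` and `strTo` are mutually inverse bijections between the two kinds
of operation. Algebra structures on a fixed carrier therefore correspond.

The hom-objects on both sides are subobjects of `V^S(A, B)`, so it suffices that the same
generalized elements `h : Z ⟶ V^S(A, B)` satisfy the two equalizer conditions. Transposition turns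
the conditions into squares in `V` with an extra factor `Z`, and the bijection persists in the
presence of that factor: `transpose_strOf_eq_iff` and `paramPow_comp_eq_iff_powTensor`. Each
forgetful `V`-functor thus lifts through the other. Both are monic on hom-objects, so strict
inverseness only has to be checked on objects.

A term in context `Γ` is interpreted naturally in homomorphisms (`interp_naturality`). With the
variables of `Γ` counted sort by sort as an arity and with parameter `single s 1`, it becomes a
natural operation that determines the interpretation. Equations then correspond, and the isomorphism
restricts to the full sub-`V`-categories they define. -/

noncomputable section

namespace MultiSorted

/-! ### Faithful `V`-functors and isomorphisms in slices -/

section Faithful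

universe u₄

variable {V : Type v} [Category.{w} V] [MonoidalCategory V]
variable {C : Type u₁} [EnrichedCategory V C] {D : Type u₂} [EnrichedCategory V D]
  {E : Type u₃} [EnrichedCategory V E]

/-- The structural morphisms have different types until the object maps are identified, hence `HEq`.
In every application the object maps agree by `rfl`. -/
theorem enrichedFunctor_ext {F G : EnrichedFunctor V C D} (hobj : F.obj = G.obj)
    (hmap : ∀ X Y, HEq (F.map X Y) (G.map X Y)) : F = G := by
  obtain ⟨Fo, Fm, hF, hF'⟩ := F
  obtain ⟨Go, Gm, hG, hG'⟩ := G
  obtain rfl : Fo = Go := hobj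
  congr
  funext X Y
  exact eq_of_heq (hmap X Y)

theorem enrichedFunctor_comp_assoc {K : Type u₄} [EnrichedCategory V K]
    (F : EnrichedFunctor V C D) (G : EnrichedFunctor V D E) (H : EnrichedFunctor V E K) :
    (F.comp V G).comp V H = F.comp V (G.comp V H) :=
  enrichedFunctor_ext rfl fun _ _ => heq_of_eq (Category.assoc _ _ _)

theorem enrichedFunctor_id_comp (F : EnrichedFunctor V C D) :
    (EnrichedFunctor.id V C).comp V F = F :=
  enrichedFunctor_ext rfl fun _ _ => heq_of_eq (Category.id_comp _)

/-- `V`-functors with the same action on objects are equal as soon as they become equal after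
composition with a faithful `V`-functor. -/
theorem enrichedFunctor_ext_of_mono (U : EnrichedFunctor V D E) (hU : ∀ A B, Mono (U.map A B))
    {F G : EnrichedFunctor V C D} (hobj : ∀ X, F.obj X = G.obj X)
    (h : F.comp V U = G.comp V U) : F = G := by
  obtain ⟨Fo, Fm, hF, hF'⟩ := F
  obtain ⟨Go, Gm, hG, hG'⟩ := G
  obtain rfl : Fo = Go := funext hobj
  -- With the object maps identified, equality of the composites is an equality of families of
  -- structural morphisms, without transport.
  have hm : (fun A B => Fm A B ≫ U.map (Fo A) (Fo B)) = fun A B => Gm A B ≫ U.map (Fo A) (Fo B) := by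
    simpa [EnrichedFunctor.comp] using h
  congr
  funext A B
  have := hU (Fo A) (Fo B)
  exact (cancel_mono (U.map (Fo A) (Fo B))).1 (congrFun (congrFun hm A) B)

/-- Isomorphisms over `E` from `V`-functors over `E` that are inverse to each other on objects,
when the `V`-functors to `E` are faithful. -/
def IsoOver.ofFaithful {UC : EnrichedFunctor V C E} {UD : EnrichedFunctor V D E}
    (hC : ∀ A B, Mono (UC.map A B)) (hD : ∀ A B, Mono (UD.map A B))
    (F : EnrichedFunctor V C D) (G : EnrichedFunctor V D C)
    (hF : F.comp V UD = UC) (hG : G.comp V UC = UD)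
    (hFG : ∀ X, G.obj (F.obj X) = X) (hGF : ∀ Y, F.obj (G.obj Y) = Y) : IsoOver UC UD where
  functor := F
  inverse := G
  functor_comp_inverse := enrichedFunctor_ext_of_mono UC hC hFG (by
    rw [enrichedFunctor_comp_assoc, hG, hF, enrichedFunctor_id_comp])
  inverse_comp_functor := enrichedFunctor_ext_of_mono UD hD hGF (by
    rw [enrichedFunctor_comp_assoc, hF, hG, enrichedFunctor_id_comp])
  functor_over := hF
  inverse_over := hG

/-- The restriction of a `V`-functor to full sub-`V`-categories. -/
def fullSubMap {p : C → Prop} {q : D → Prop} (F : EnrichedFunctor V C D)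
    (h : ∀ X, p X → q (F.obj X)) : EnrichedFunctor V {X // p X} {Y // q Y} where
  obj X := ⟨F.obj X.1, h X.1 X.2⟩
  map X Y := F.map X.1 Y.1
  map_id X := F.map_id X.1
  map_comp X Y Z := F.map_comp X.1 Y.1 Z.1

theorem fullSubMap_comp_inclusion {p : C → Prop} {q : D → Prop} {UC : EnrichedFunctor V C E}
    {UD : EnrichedFunctor V D E} (F : EnrichedFunctor V C D) (h : ∀ X, p X → q (F.obj X))
    (hF : F.comp V UD = UC) :
    (fullSubMap F h).comp V ((fullSubInclusion q).comp V UD) = (fullSubInclusion p).comp V UC := by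
  subst hF
  refine enrichedFunctor_ext rfl fun X Y => heq_of_eq ?_
  exact (congrArg (fun k => F.map X.1 Y.1 ≫ k) (Category.id_comp _)).trans
    (Category.id_comp _).symm

theorem mono_fullSubInclusion_comp {p : C → Prop} {UC : EnrichedFunctor V C E}
    (hC : ∀ A B, Mono (UC.map A B)) (A B : {X // p X}) :
    Mono (((fullSubInclusion p).comp V UC).map A B) := by
  have h : ((fullSubInclusion p).comp V UC).map A B = UC.map A.1 B.1 := Category.id_comp _
  exact h ▸ hC A.1 B.1

/-- Corresponding full sub-`V`-categories are isomorphic over `E`. -/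
def IsoOver.fullSub {UC : EnrichedFunctor V C E} {UD : EnrichedFunctor V D E}
    (Φ : IsoOver UC UD) (hC : ∀ A B, Mono (UC.map A B)) (hD : ∀ A B, Mono (UD.map A B))
    {p : C → Prop} {q : D → Prop} (hpq : ∀ X, p X ↔ q (Φ.functor.obj X)) :
    IsoOver ((fullSubInclusion p).comp V UC) ((fullSubInclusion q).comp V UD) :=
  have hFG : ∀ X, Φ.inverse.obj (Φ.functor.obj X) = X := fun X =>
    congrArg (fun H => EnrichedFunctor.obj H X) Φ.functor_comp_inverse
  have hGF : ∀ Y, Φ.functor.obj (Φ.inverse.obj Y) = Y := fun Y =>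
    congrArg (fun H => EnrichedFunctor.obj H Y) Φ.inverse_comp_functor
  IsoOver.ofFaithful (mono_fullSubInclusion_comp hC) (mono_fullSubInclusion_comp hD)
    (fullSubMap Φ.functor fun X => (hpq X).1)
    (fullSubMap Φ.inverse fun Y hY => (hpq _).2 ((hGF Y).symm ▸ hY))
    (fullSubMap_comp_inclusion _ _ Φ.functor_over) (fullSubMap_comp_inclusion _ _ Φ.inverse_over)
    (fun X => Subtype.ext (hFG X.1)) (fun Y => Subtype.ext (hGF Y.1))

end Faithful

/-! ### Transposes of the structural morphisms -/

section Transposes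

variable {V : Type v} [Category.{w} V] [CartesianMonoidalCategory V]

theorem rightUnitor_inv_tensorHom {X X' Y Z : V} (a : X ⟶ X') (b : 𝟙_ V ⟶ Y)
    (c : X' ⊗ Y ⟶ Z) :
    (ρ_ X).inv ≫ (a ⊗ₘ b) ≫ c = a ≫ (ρ_ X').inv ≫ X' ◁ b ≫ c := by
  rw [MonoidalCategory.tensorHom_def, Category.assoc, rightUnitor_inv_naturality_assoc]

theorem leftUnitor_inv_tensorHom {X Y Y' Z : V} (a : 𝟙_ V ⟶ X) (b : Y ⟶ Y')
    (c : X ⊗ Y' ⟶ Z) :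
    (λ_ Y).inv ≫ (a ⊗ₘ b) ≫ c = b ≫ (λ_ Y').inv ≫ a ▷ Y' ≫ c := by
  rw [tensorHom_def', Category.assoc, leftUnitor_inv_naturality_assoc]

theorem whiskerLeft_comp_lift {X Y Z W : V} (Q : V) (h : Z ⟶ W) (e : X ⊗ W ⟶ Y) :
    (X ⊗ Q) ◁ h ≫ lift (fst X Q ▷ W ≫ e) (fst (X ⊗ Q) W ≫ snd X Q) =
      lift (fst X Q ▷ Z ≫ X ◁ h ≫ e) (fst (X ⊗ Q) Z ≫ snd X Q) := by
  rw [comp_lift, whisker_exchange_assoc, whiskerLeft_fst_assoc]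

variable [MonoidalClosed V]

/-- After transposition, whiskering of hom-objects is ordinary composition, so conditions on a
generalized element `h` of a hom-object become equations between morphisms out of `X ⊗ Z`. -/
theorem uncurry_eHomWhiskerLeft {X Y Y' Z : V} (h : Z ⟶ (ihom X).obj Y) (g : Y ⟶ Y') :
    MonoidalClosed.uncurry (h ≫ eHomWhiskerLeft V X g) = MonoidalClosed.uncurry h ≫ g := by
  rw [MonoidalClosed.enrichedOrdinaryCategorySelf_eHomWhiskerLeft]
  exact MonoidalClosed.uncurry_natural_right _ _

theorem uncurry_eHomWhiskerRight {X X' Y Z : V} (h : Z ⟶ (ihom X').obj Y) (f : X ⟶ X') :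
    MonoidalClosed.uncurry (h ≫ eHomWhiskerRight V f Y) = f ▷ Z ≫ MonoidalClosed.uncurry h := by
  rw [MonoidalClosed.enrichedOrdinaryCategorySelf_eHomWhiskerRight]
  exact MonoidalClosed.uncurry_pre_app Y h f

theorem uncurry_comp_curry {X Y Z W : V} (h : Z ⟶ W) (g : X ⊗ W ⟶ Y) :
    MonoidalClosed.uncurry (h ≫ MonoidalClosed.curry g) = X ◁ h ≫ g := by
  rw [MonoidalClosed.uncurry_natural_left, MonoidalClosed.uncurry_curry]

theorem uncurry_tensorLeftFunctor_map (P : V) {X Y Z : V} (h : Z ⟶ (ihom X).obj Y) :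
    MonoidalClosed.uncurry (h ≫ (tensorLeftFunctor P).map X Y) =
      (α_ P X Z).hom ≫ P ◁ MonoidalClosed.uncurry h := by
  refine (uncurry_comp_curry _ _).trans ?_
  rw [MonoidalClosed.uncurry_eq, MonoidalCategory.whiskerLeft_comp]
  exact associator_naturality_right_assoc P X h _

/-- Here `Q` stands between `X` and `Z`, so the transpose is a pairing of projections where
`tensorLeftFunctor` needs only an associator. -/
theorem uncurry_tensorRightFunctor_map (Q : V) {X Y Z : V} (h : Z ⟶ (ihom X).obj Y) :
    MonoidalClosed.uncurry (h ≫ (tensorRightFunctor Q).map X Y) =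
      lift (fst X Q ▷ Z ≫ MonoidalClosed.uncurry h) (fst (X ⊗ Q) Z ≫ snd X Q) := by
  refine (uncurry_comp_curry _ _).trans ?_
  rw [MonoidalClosed.uncurry_eq]
  exact whiskerLeft_comp_lift Q h _

variable [HasLimits V] {S : Type w}

/-- Composition and points in `V^S` are formed sortwise; this splits the free-form homomorphism
condition into one condition per sort. -/
theorem pi_eHomWhiskerLeft (X : S → V) {Y Y' : S → V} (g : Y ⟶ Y') (s : S) :
    eHomWhiskerLeft V X g ≫ Pi.π (fun s => (ihom (X s)).obj (Y' s)) s =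
      Pi.π (fun s => (ihom (X s)).obj (Y s)) s ≫ eHomWhiskerLeft V (X s) (g s) := by
  have h : eComp V X Y Y' ≫ Pi.π (fun s => (ihom (X s)).obj (Y' s)) s =
      (Pi.π (fun s => (ihom (X s)).obj (Y s)) s ⊗ₘ Pi.π (fun s => (ihom (Y s)).obj (Y' s)) s) ≫
        eComp V (X s) (Y s) (Y' s) := Pi.lift_π _ _
  have h' : eHomEquiv V g ≫ Pi.π (fun s => (ihom (Y s)).obj (Y' s)) s = eHomEquiv V (g s) :=
    Pi.lift_π _ _
  rw [eHomWhiskerLeft, eHomWhiskerLeft, Category.assoc, Category.assoc, h, ← id_tensorHom,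
    tensorHom_comp_tensorHom_assoc, h', Category.id_comp]
  exact rightUnitor_inv_tensorHom _ _ _

theorem pi_eHomWhiskerRight {X X' : S → V} (f : X ⟶ X') (Y : S → V) (s : S) :
    eHomWhiskerRight V f Y ≫ Pi.π (fun s => (ihom (X s)).obj (Y s)) s =
      Pi.π (fun s => (ihom (X' s)).obj (Y s)) s ≫ eHomWhiskerRight V (f s) (Y s) := by
  have h : eComp V X X' Y ≫ Pi.π (fun s => (ihom (X s)).obj (Y s)) s =
      (Pi.π (fun s => (ihom (X s)).obj (X' s)) s ⊗ₘ Pi.π (fun s => (ihom (X' s)).obj (Y s)) s) ≫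
        eComp V (X s) (X' s) (Y s) := Pi.lift_π _ _
  have h' : eHomEquiv V f ≫ Pi.π (fun s => (ihom (X s)).obj (X' s)) s = eHomEquiv V (f s) :=
    Pi.lift_π _ _
  rw [eHomWhiskerRight, eHomWhiskerRight, Category.assoc, Category.assoc, h, ← tensorHom_id,
    tensorHom_comp_tensorHom_assoc, h', Category.id_comp]
  exact leftUnitor_inv_tensorHom _ _ _

end Transposes

/-! ### Parameters concentrated in one sort -/

section Single

variable {V : Type v} [Category.{w} V] [HasColimits V] {S : Type w}

/-- The object of `V^S` that is `P` at the sort `s` and initial at all other sorts. -/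
def single (s : S) (P : V) : S → V := fun t => ∐ fun _ : ULift.{w} (PLift (s = t)) => P

/-- The universal element of `single s P`. -/
def singleι (s : S) (P : V) : P ⟶ single s P s :=
  Sigma.ι (fun _ : ULift.{w} (PLift (s = s)) => P) ⟨⟨rfl⟩⟩

variable [CartesianMonoidalCategory V]

/-- The restriction of a morphism `Y ⊗ single s P ⟶ X` to `P × Y ⟶ X s`. -/
def strOf {s : S} {P Y : V} {X : S → V} (g : tensor Y (single s P) ⟶ X) : P ⊗ Y ⟶ X s :=
  lift (snd P Y) (fst P Y ≫ singleι s P) ≫ g s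

theorem strOf_tensorMap {s : S} {P Y Y' : V} {X : S → V} (y : Y ⟶ Y')
    (g : tensor Y' (single s P) ⟶ X) :
    strOf (tensorMap y (single s P) ≫ g) = P ◁ y ≫ strOf g := by
  have h : lift (snd P Y) (fst P Y ≫ singleι s P) ≫ y ▷ single s P s =
      P ◁ y ≫ lift (snd P Y') (fst P Y' ≫ singleι s P) := by
    refine CartesianMonoidalCategory.hom_ext _ _ ?_ ?_ <;> simp
  rw [strOf, strOf, ← Category.assoc, ← h, Category.assoc]
  rfl

theorem strOf_comp {s : S} {P Y : V} {X X' : S → V} (g : tensor Y (single s P) ⟶ X) (f : X ⟶ X') :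
    strOf (g ≫ f) = strOf g ≫ f s := (Category.assoc _ _ _).symm

variable [MonoidalClosed V]

/-- Transposition makes `single s P t` the domain, where the coproduct property applies: its index
type is empty unless `s = t`, and then has one element. -/
theorem tensor_single_ext {s : S} {P Y : V} {X : S → V} {g g' : tensor Y (single s P) ⟶ X}
    (h : Y ◁ singleι s P ≫ g s = Y ◁ singleι s P ≫ g' s) : g = g' := by
  funext t
  refine MonoidalClosed.curry_injective (Sigma.hom_ext _ _ ?_)
  rintro ⟨⟨rfl⟩⟩
  have := congrArg MonoidalClosed.curry h
  rwa [MonoidalClosed.curry_natural_left, MonoidalClosed.curry_natural_left] at this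

/-- The extension of a morphism `P × Y ⟶ X s` to `Y ⊗ single s P ⟶ X`. -/
def strTo {s : S} {P Y : V} {X : S → V} (f : P ⊗ Y ⟶ X s) : tensor Y (single s P) ⟶ X := fun _ =>
  MonoidalClosed.uncurry (Sigma.desc fun h =>
    MonoidalClosed.curry (lift (snd Y P) (fst Y P) ≫ f ≫ eqToHom (congrArg X h.down.down)))

theorem strOf_strTo {s : S} {P Y : V} {X : S → V} (f : P ⊗ Y ⟶ X s) : strOf (strTo f) = f := by
  have h : Y ◁ singleι s P ≫ strTo f s = lift (snd Y P) (fst Y P) ≫ f := by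
    refine (MonoidalClosed.uncurry_natural_left _ _).symm.trans ?_
    refine (congrArg MonoidalClosed.uncurry (Sigma.ι_desc _ _)).trans ?_
    -- The summand picked out by `singleι` has index `rfl`, so the transport along the equality of
    -- sorts is trivial.
    rw [MonoidalClosed.uncurry_curry, eqToHom_refl, Category.comp_id]
  have h' : lift (snd P Y) (fst P Y ≫ singleι s P) =
      lift (snd P Y) (fst P Y) ≫ Y ◁ singleι s P := by simp
  rw [strOf, h', Category.assoc, h, ← Category.assoc]
  simp

theorem strOf_injective {s : S} {P Y : V} {X : S → V} :
    Function.Injective (strOf (s := s) (P := P) (Y := Y) (X := X)) := fun g g' h => by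
  refine tensor_single_ext ?_
  -- Swapping the factors turns `strOf` back into restriction along `Y ◁ singleι s P`.
  have := congrArg (fun k => lift (snd Y P) (fst Y P) ≫ k) h
  have h' : lift (snd Y P) (fst Y P) ≫ lift (snd P Y) (fst P Y ≫ singleι s P) =
      Y ◁ singleι s P := by
    refine CartesianMonoidalCategory.hom_ext _ _ ?_ ?_ <;> simp
  simpa only [strOf, ← Category.assoc, h'] using this

theorem strTo_strOf {s : S} {P Y : V} {X : S → V} (g : tensor Y (single s P) ⟶ X) :
    strTo (strOf g) = g := strOf_injective (strOf_strTo _)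

/-- The extra factor `Z` is the domain of a generalized element of a hom-object. Permuting it next
to `Y` reduces the claim to `tensor_single_ext` with `Y ⊗ Z` in place of `Y`. -/
theorem tensor_single_tensor_ext {s : S} {P Y Z : V} {X : S → V}
    {g g' : ∀ t, (Y ⊗ single s P t) ⊗ Z ⟶ X t}
    (h : lift (snd P Y) (fst P Y ≫ singleι s P) ▷ Z ≫ g s =
      lift (snd P Y) (fst P Y ≫ singleι s P) ▷ Z ≫ g' s) : g = g' := by
  let p (Q : V) : (Y ⊗ Z) ⊗ Q ⟶ (Y ⊗ Q) ⊗ Z :=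
    lift (lift (fst (Y ⊗ Z) Q ≫ fst Y Z) (snd (Y ⊗ Z) Q)) (fst (Y ⊗ Z) Q ≫ snd Y Z)
  let p' (Q : V) : (Y ⊗ Q) ⊗ Z ⟶ (Y ⊗ Z) ⊗ Q :=
    lift (lift (fst (Y ⊗ Q) Z ≫ fst Y Q) (snd (Y ⊗ Q) Z)) (fst (Y ⊗ Q) Z ≫ snd Y Q)
  -- This composite alone suffices: it makes `p Q` a split epimorphism, which can be cancelled at
  -- the end.
  have hp (Q : V) : p' Q ≫ p Q = 𝟙 _ := by
    refine CartesianMonoidalCategory.hom_ext _ _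
      (CartesianMonoidalCategory.hom_ext _ _ ?_ ?_) ?_ <;> simp [p, p']
  have hι : (Y ⊗ Z) ◁ singleι s P ≫ p (single s P s) =
      lift (lift (snd (Y ⊗ Z) P) (fst (Y ⊗ Z) P ≫ fst Y Z)) (fst (Y ⊗ Z) P ≫ snd Y Z) ≫
        lift (snd P Y) (fst P Y ≫ singleι s P) ▷ Z := by
    refine CartesianMonoidalCategory.hom_ext _ _
      (CartesianMonoidalCategory.hom_ext _ _ ?_ ?_) ?_ <;> simp [p]
  have key : (fun t => p (single s P t) ≫ g t : tensor (Y ⊗ Z) (single s P) ⟶ X) =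
      fun t => p (single s P t) ≫ g' t :=
    tensor_single_ext (by rw [← Category.assoc, ← Category.assoc, hι, Category.assoc, h,
      Category.assoc])
  funext t
  have := congrArg (fun k => p' (single s P t) ≫ k) (congrFun key t)
  simpa only [← Category.assoc, hp, Category.id_comp] using this

end Single

/-! ### The free-form signature of an enriched signature -/

namespace EnrichedSignature

variable {V : Type v} [Category.{w} V] [CartesianMonoidalCategory V] [MonoidalClosed V]
  [HasLimits V] {S : Type w}

/-- The condition for a generalized element of `V^S(A, B)` to be a homomorphism, in terms of
transposes. -/
theorem paramPow_comp_eq_iff {A B : S → V} {J : S →₀ ℕ} {P : V} {s : S}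
    (f : P ⊗ pow A J ⟶ A s) (f' : P ⊗ pow B J ⟶ B s) {Z : V} (h : Z ⟶ (A ⟶[V] B)) :
    h ≫ (paramPowFunctor P J).map A B ≫ eHomWhiskerLeft V (P ⊗ pow A J) f' =
        h ≫ (projFunctor s).map A B ≫ eHomWhiskerRight V f (B s) ↔
      (α_ P (pow A J) Z).hom ≫ P ◁ MonoidalClosed.uncurry (h ≫ (powFunctor J).map A B) ≫ f' =
        f ▷ Z ≫ MonoidalClosed.uncurry (h ≫ Pi.π (fun s => (ihom (A s)).obj (B s)) s) := by
  have h1 : MonoidalClosed.uncurry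
        (h ≫ (paramPowFunctor P J).map A B ≫ eHomWhiskerLeft V (P ⊗ pow A J) f') =
      (α_ P (pow A J) Z).hom ≫
        P ◁ MonoidalClosed.uncurry (h ≫ (powFunctor J).map A B) ≫ f' := by
    refine (congrArg MonoidalClosed.uncurry (Category.assoc h _ _).symm).trans ?_
    refine (uncurry_eHomWhiskerLeft (h ≫ (paramPowFunctor P J).map A B) f').trans ?_
    have := uncurry_tensorLeftFunctor_map P (h ≫ (powFunctor J).map A B)
    rw [Category.assoc] at this
    exact (congrArg (fun k => k ≫ f') this).trans (Category.assoc _ _ _)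
  have h2 : MonoidalClosed.uncurry
        (h ≫ (projFunctor s).map A B ≫ eHomWhiskerRight V f (B s)) =
      f ▷ Z ≫ MonoidalClosed.uncurry (h ≫ Pi.π (fun s => (ihom (A s)).obj (B s)) s) := by
    refine (congrArg MonoidalClosed.uncurry (Category.assoc h _ _).symm).trans ?_
    exact uncurry_eHomWhiskerRight (h ≫ (projFunctor s).map A B) f
  rw [← h1, ← h2]
  exact MonoidalClosed.uncurry_injective.eq_iff.symm

/-- The condition for a generalized element of `V^S(A, B)` to be a homomorphism for operations with
parameters in `V^S`, in terms of transposes. -/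
theorem powTensor_comp_eq_iff {A B : S → V} {J : S →₀ ℕ} {Q : S → V}
    (g : tensor (pow A J) Q ⟶ A) (g' : tensor (pow B J) Q ⟶ B) {Z : V} (h : Z ⟶ (A ⟶[V] B)) :
    h ≫ (powTensorFunctor J Q).map A B ≫ eHomWhiskerLeft V (tensor (pow A J) Q) g' =
        h ≫ (EnrichedFunctor.id V (S → V)).map A B ≫ eHomWhiskerRight V g B ↔
      ∀ t, lift (fst (pow A J) (Q t) ▷ Z ≫ MonoidalClosed.uncurry (h ≫ (powFunctor J).map A B))
            (fst (pow A J ⊗ Q t) Z ≫ snd (pow A J) (Q t)) ≫ g' t =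
        g t ▷ Z ≫ MonoidalClosed.uncurry (h ≫ Pi.π (fun s => (ihom (A s)).obj (B s)) t) := by
  have h1 (t : S) : MonoidalClosed.uncurry
        ((h ≫ (powTensorFunctor J Q).map A B ≫ eHomWhiskerLeft V (tensor (pow A J) Q) g') ≫
          Pi.π (fun s => (ihom (tensor (pow A J) Q s)).obj (B s)) t) =
      lift (fst (pow A J) (Q t) ▷ Z ≫ MonoidalClosed.uncurry (h ≫ (powFunctor J).map A B))
        (fst (pow A J ⊗ Q t) Z ≫ snd (pow A J) (Q t)) ≫ g' t := by
    -- In sort `t`, the `V`-functor `(-)^J ⊗ Q` is `(-)^J` followed by `(-) × Q t`.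
    have hπ : (powTensorFunctor J Q).map A B ≫
        Pi.π (fun s => (ihom (tensor (pow A J) Q s)).obj (tensor (pow B J) Q s)) t =
        (powFunctor J).map A B ≫ (tensorRightFunctor (Q t)).map (pow A J) (pow B J) := by
      refine (Category.assoc _ _ _).trans ?_
      exact congrArg (fun k => (powFunctor J).map A B ≫ k) (Pi.lift_π _ _)
    have e1 : ((powTensorFunctor J Q).map A B ≫
          eHomWhiskerLeft V (tensor (pow A J) Q) g') ≫
          Pi.π (fun s => (ihom (tensor (pow A J) Q s)).obj (B s)) t =
        (powFunctor J).map A B ≫ (tensorRightFunctor (Q t)).map (pow A J) (pow B J) ≫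
          eHomWhiskerLeft V (pow A J ⊗ Q t) (g' t) :=
      (Category.assoc _ _ _).trans ((congrArg (fun k => (powTensorFunctor J Q).map A B ≫ k)
        (pi_eHomWhiskerLeft _ g' t)).trans ((Category.assoc _ _ _).symm.trans
          ((congrArg (fun k => k ≫ eHomWhiskerLeft V (pow A J ⊗ Q t) (g' t)) hπ).trans
            (Category.assoc _ _ _))))
    have e2 : (h ≫ (powTensorFunctor J Q).map A B ≫
          eHomWhiskerLeft V (tensor (pow A J) Q) g') ≫
          Pi.π (fun s => (ihom (tensor (pow A J) Q s)).obj (B s)) t =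
        ((h ≫ (powFunctor J).map A B) ≫ (tensorRightFunctor (Q t)).map (pow A J) (pow B J)) ≫
          eHomWhiskerLeft V (pow A J ⊗ Q t) (g' t) :=
      (Category.assoc _ _ _).trans ((congrArg (fun k => h ≫ k) e1).trans
        ((Category.assoc _ _ _).symm.trans (Category.assoc _ _ _).symm))
    refine (congrArg MonoidalClosed.uncurry e2).trans ((uncurry_eHomWhiskerLeft
      ((h ≫ (powFunctor J).map A B) ≫ (tensorRightFunctor (Q t)).map (pow A J) (pow B J)) _).trans ?_)
    exact congrArg (fun k => k ≫ g' t) (uncurry_tensorRightFunctor_map (Q t) _)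
  have h2 (t : S) : MonoidalClosed.uncurry
        ((h ≫ (EnrichedFunctor.id V (S → V)).map A B ≫ eHomWhiskerRight V g B) ≫
          Pi.π (fun s => (ihom (tensor (pow A J) Q s)).obj (B s)) t) =
      g t ▷ Z ≫ MonoidalClosed.uncurry (h ≫ Pi.π (fun s => (ihom (A s)).obj (B s)) t) := by
    refine Eq.trans (congrArg MonoidalClosed.uncurry ?_) (uncurry_eHomWhiskerRight
      (h ≫ Pi.π (fun s => (ihom (A s)).obj (B s)) t) (g t))
    exact (congrArg (fun k => (h ≫ k) ≫ _) (Category.id_comp _)).trans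
      ((Category.assoc _ _ _).trans ((congrArg (fun k => h ≫ k) (pi_eHomWhiskerRight g B t)).trans
        (Category.assoc _ _ _).symm))
  constructor
  · intro hh t
    rw [← h1, ← h2]
    exact congrArg (fun k => MonoidalClosed.uncurry
      (k ≫ Pi.π (fun s => (ihom (tensor (pow A J) Q s)).obj (B s)) t)) hh
  · intro hh
    refine Pi.hom_ext _ _ fun t => MonoidalClosed.uncurry_injective ?_
    exact (h1 t).trans ((hh t).trans (h2 t).symm)

end EnrichedSignature

/-! ### Comparison of the two homomorphism conditions -/

section

variable {V : Type v} [Category.{w} V] [CartesianMonoidalCategory V] [MonoidalClosed V]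
  [HasColimits V] {S : Type w}

/-- Restricting the free-form square at sort `s` along `P ⟶ single s P s` gives the other square,
and by `tensor_single_tensor_ext` that restriction determines the squares in all sorts. In the
application, `u` and `k` are the transposed actions of a generalized element on `A^J` and on each
sort. -/
theorem transpose_strOf_eq_iff {P Y Y' Z : V} {s : S} {X X' : S → V}
    (g : tensor Y (single s P) ⟶ X) (g' : tensor Y' (single s P) ⟶ X')
    (u : Y ⊗ Z ⟶ Y') (k : ∀ t, X t ⊗ Z ⟶ X' t) :
    (α_ P Y Z).hom ≫ P ◁ u ≫ strOf g' = strOf g ▷ Z ≫ k s ↔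
      ∀ t, lift (fst Y (single s P t) ▷ Z ≫ u)
          (fst (Y ⊗ single s P t) Z ≫ snd Y (single s P t)) ≫ g' t = g t ▷ Z ≫ k t := by
  -- In elements, both sides send `((p, y), z)` to `(u (y, z), ι p)`.
  have e : lift (snd P Y) (fst P Y ≫ singleι s P) ▷ Z ≫
      lift (fst Y (single s P s) ▷ Z ≫ u)
        (fst (Y ⊗ single s P s) Z ≫ snd Y (single s P s)) =
      (α_ P Y Z).hom ≫ P ◁ u ≫ lift (snd P Y') (fst P Y' ≫ singleι s P) := by
    have h : (α_ P Y Z).hom ≫ snd P (Y ⊗ Z) = snd P Y ▷ Z := by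
      refine CartesianMonoidalCategory.hom_ext _ _ ?_ ?_ <;> simp
    refine CartesianMonoidalCategory.hom_ext _ _ ?_ ?_
    · rw [Category.assoc, lift_fst, ← comp_whiskerRight_assoc, lift_fst, Category.assoc,
        Category.assoc, lift_fst, whiskerLeft_snd, ← Category.assoc (α_ P Y Z).hom, h]
    · simp
  constructor
  · intro hh
    refine congrFun (tensor_single_tensor_ext ?_)
    rw [← Category.assoc, e, ← comp_whiskerRight_assoc]
    simpa only [strOf, Category.assoc] using hh
  · intro hh
    have := congrArg (fun k => lift (snd P Y) (fst P Y ≫ singleι s P) ▷ Z ≫ k) (hh s)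
    simp only at this
    rw [← Category.assoc, e, ← comp_whiskerRight_assoc] at this
    simpa only [strOf, Category.assoc] using this

end

namespace EnrichedSignature

variable {V : Type v} [Category.{w} V] [CartesianMonoidalCategory V] [MonoidalClosed V]
  [HasLimits V] [HasColimits V] {S : Type w}

/-- As `h` is arbitrary, the two pairwise equalizers are the same subobject of `V^S(A, B)`. -/
theorem paramPow_comp_eq_iff_powTensor {A B : S → V} {J : S →₀ ℕ} {P : V} {s : S}
    {f : P ⊗ pow A J ⟶ A s} {f' : P ⊗ pow B J ⟶ B s}
    {g : tensor (pow A J) (single s P) ⟶ A} {g' : tensor (pow B J) (single s P) ⟶ B}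
    (hg : strOf g = f) (hg' : strOf g' = f') {Z : V} (h : Z ⟶ (A ⟶[V] B)) :
    h ≫ (paramPowFunctor P J).map A B ≫ eHomWhiskerLeft V (P ⊗ pow A J) f' =
        h ≫ (projFunctor s).map A B ≫ eHomWhiskerRight V f (B s) ↔
      h ≫ (powTensorFunctor J (single s P)).map A B ≫
          eHomWhiskerLeft V (tensor (pow A J) (single s P)) g' =
        h ≫ (EnrichedFunctor.id V (S → V)).map A B ≫ eHomWhiskerRight V g B := by
  refine (paramPow_comp_eq_iff f f' h).trans
    (Iff.trans ?_ (powTensor_comp_eq_iff g g' h).symm)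
  subst hg hg'
  exact transpose_strOf_eq_iff g g' (MonoidalClosed.uncurry (h ≫ (powFunctor J).map A B))
    fun t => MonoidalClosed.uncurry (h ≫ Pi.π (fun s => (ihom (A s)).obj (B s)) t)

/-- The free-form signature with the same operation symbols, whose parameters are concentrated in
the output sorts. -/
def freeForm (Sg : EnrichedSignature V S) : FreeFormSignature V S where
  Op := Sg.Op
  arity := Sg.arity
  param σ := single (Sg.out σ) (Sg.param σ)

variable {Sg : EnrichedSignature V S}

/-- The algebra for the free-form signature that corresponds to an algebra. -/
def Alg.toFreeForm (A : Sg.Alg) : Sg.freeForm.Alg where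
  carrier := A.carrier
  op σ := strTo (A.op σ)

/-- The algebra that corresponds to an algebra for the free-form signature. -/
def Alg.ofFreeForm (A : Sg.freeForm.Alg) : Sg.Alg where
  carrier := A.carrier
  op σ := strOf (A.op σ)

theorem Alg.ofFreeForm_toFreeForm (A : Sg.Alg) : Alg.ofFreeForm A.toFreeForm = A := by
  obtain ⟨X, a⟩ := A
  exact congrArg (Alg.mk X) (funext fun σ => strOf_strTo (a σ))

theorem Alg.toFreeForm_ofFreeForm (A : Sg.freeForm.Alg) : (Alg.ofFreeForm A).toFreeForm = A := by
  obtain ⟨X, a⟩ := A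
  exact congrArg (FreeFormSignature.Alg.mk X) (funext fun σ => strTo_strOf (a σ))

end EnrichedSignature

/-! ### Lifting `V`-functors through pairwise equalizers -/

namespace StructuredObj

universe u₄

variable {V : Type v} [Category.{w} V] [MonoidalCategory V] [HasLimits V]
variable {C : Type u₁} [EnrichedCategory V C]
variable {D : Type u₂} [Category.{u₃} D] [EnrichedOrdinaryCategory V D]
variable {ι : Type w} {F G : ι → EnrichedFunctor V C D}

/-- The factorization of a generalized element of `C(A, B)` through the pairwise equalizer. -/
def homLift {A B : StructuredObj F G} {Z : V} (h : Z ⟶ (A.obj ⟶[V] B.obj))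
    (hh : ∀ i, h ≫ (F i).map A.obj B.obj ≫ eHomWhiskerLeft V ((F i).obj A.obj) (B.str i) =
      h ≫ (G i).map A.obj B.obj ≫ eHomWhiskerRight V (A.str i) ((G i).obj B.obj)) :
    Z ⟶ (A ⟶[V] B) :=
  equalizer.lift h (by
    refine Pi.hom_ext _ _ fun i => ?_
    simp only [homLeft, homRight, Category.assoc, Pi.lift_π]
    exact hh i)

theorem homLift_ι {A B : StructuredObj F G} {Z : V} (h : Z ⟶ (A.obj ⟶[V] B.obj))
    (hh : ∀ i, h ≫ (F i).map A.obj B.obj ≫ eHomWhiskerLeft V ((F i).obj A.obj) (B.str i) =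
      h ≫ (G i).map A.obj B.obj ≫ eHomWhiskerRight V (A.str i) ((G i).obj B.obj)) :
    homLift h hh ≫ homι A B = h :=
  equalizer.lift_ι _ _

/-- The lift of a `V`-functor to structured objects, from compatible structure morphisms. -/
def liftFunctor {K : Type u₄} [EnrichedCategory V K] (W : EnrichedFunctor V K C)
    (str : ∀ A i, (F i).obj (W.obj A) ⟶ (G i).obj (W.obj A))
    (hstr : ∀ A B i,
      W.map A B ≫ (F i).map (W.obj A) (W.obj B) ≫ eHomWhiskerLeft V _ (str B i) =
        W.map A B ≫ (G i).map (W.obj A) (W.obj B) ≫ eHomWhiskerRight V (str A i) _) :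
    EnrichedFunctor V K (StructuredObj F G) where
  obj A := ⟨W.obj A, str A⟩
  map A B := homLift (A := ⟨W.obj A, str A⟩) (B := ⟨W.obj B, str B⟩) (W.map A B) (hstr A B)
  map_id A := by
    -- The inclusions of the equalizers are monic, so functoriality is inherited from `W`.
    refine (cancel_mono (homι (V := V) (F := F) (G := G) _ _)).1 ?_
    rw [Category.assoc, homLift_ι, W.map_id]
    exact (homId_ι (V := V) (F := F) (G := G) ⟨W.obj A, str A⟩).symm
  map_comp A B E := by
    refine (cancel_mono (homι (V := V) (F := F) (G := G) _ _)).1 ?_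
    rw [Category.assoc, homLift_ι, W.map_comp, Category.assoc]
    refine Eq.trans ?_ (congrArg (fun k => _ ≫ k) (homComp_ι (V := V) (F := F) (G := G)
      ⟨W.obj A, str A⟩ ⟨W.obj B, str B⟩ ⟨W.obj E, str E⟩)).symm
    refine Eq.trans ?_ (tensorHom_comp_tensorHom_assoc _ _ _ _ _).symm
    rw [homLift_ι, homLift_ι]

end StructuredObj

/-! ### The isomorphism over `V^S` -/

namespace EnrichedSignature

variable {V : Type v} [Category.{w} V] [CartesianMonoidalCategory V] [MonoidalClosed V]
  [HasLimits V] {S : Type w}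

variable (Sg : EnrichedSignature V S)

theorem forget_map_paramPow (A B : Sg.Alg) (σ : Sg.Op) :
    Sg.forget.map A B ≫ (paramPowFunctor (Sg.param σ) (Sg.arity σ)).map A.carrier B.carrier ≫
        eHomWhiskerLeft V (Sg.param σ ⊗ pow A.carrier (Sg.arity σ)) (B.op σ) =
      Sg.forget.map A B ≫ (projFunctor (Sg.out σ)).map A.carrier B.carrier ≫
        eHomWhiskerRight V (A.op σ) (B.carrier (Sg.out σ)) :=
  StructuredObj.homι_condition A.toStructuredObj B.toStructuredObj σ

theorem forget_map_powTensor (Fr : FreeFormSignature V S) (A B : Fr.Alg) (σ : Fr.Op) :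
    Fr.forget.map A B ≫ (powTensorFunctor (Fr.arity σ) (Fr.param σ)).map A.carrier B.carrier ≫
        eHomWhiskerLeft V (tensor (pow A.carrier (Fr.arity σ)) (Fr.param σ)) (B.op σ) =
      Fr.forget.map A B ≫ (EnrichedFunctor.id V (S → V)).map A.carrier B.carrier ≫
        eHomWhiskerRight V (A.op σ) B.carrier :=
  StructuredObj.homι_condition A.toStructuredObj B.toStructuredObj σ

theorem mono_forget_map (A B : Sg.Alg) : Mono (Sg.forget.map A B) :=
  inferInstanceAs (Mono (StructuredObj.homι A.toStructuredObj B.toStructuredObj))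

theorem mono_freeFormSignature_forget_map (Fr : FreeFormSignature V S) (A B : Fr.Alg) :
    Mono (Fr.forget.map A B) :=
  inferInstanceAs (Mono (StructuredObj.homι A.toStructuredObj B.toStructuredObj))

variable [HasColimits V]

/-- This is the compatibility that `liftFunctor` requires in order to lift `Sg.forget` to free-form
algebras. -/
theorem forget_map_powTensor_strTo (A B : Sg.Alg) (σ : Sg.Op) :
    Sg.forget.map A B ≫
        (powTensorFunctor (Sg.arity σ) (single (Sg.out σ) (Sg.param σ))).map A.carrier B.carrier ≫
        eHomWhiskerLeft V (tensor (pow A.carrier (Sg.arity σ)) (single (Sg.out σ) (Sg.param σ)))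
          (strTo (B.op σ)) =
      Sg.forget.map A B ≫ (EnrichedFunctor.id V (S → V)).map A.carrier B.carrier ≫
        eHomWhiskerRight V (strTo (A.op σ)) B.carrier :=
  (paramPow_comp_eq_iff_powTensor (strOf_strTo _) (strOf_strTo _) _).1
    (Sg.forget_map_paramPow A B σ)

theorem forget_map_paramPow_strOf (A B : Sg.freeForm.Alg) (σ : Sg.Op) :
    Sg.freeForm.forget.map A B ≫
        (paramPowFunctor (Sg.param σ) (Sg.arity σ)).map A.carrier B.carrier ≫
        eHomWhiskerLeft V (Sg.param σ ⊗ pow A.carrier (Sg.arity σ)) (strOf (B.op σ)) =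
      Sg.freeForm.forget.map A B ≫ (projFunctor (Sg.out σ)).map A.carrier B.carrier ≫
        eHomWhiskerRight V (strOf (A.op σ)) (B.carrier (Sg.out σ)) :=
  (paramPow_comp_eq_iff_powTensor rfl rfl _).2 (forget_map_powTensor Sg.freeForm A B σ)

/-- The `V`-functor from algebras to algebras for the free-form signature. -/
def toFreeFormFunctor : EnrichedFunctor V Sg.Alg Sg.freeForm.Alg :=
  let L := StructuredObj.liftFunctor
    (F := fun σ => powTensorFunctor (Sg.freeForm.arity σ) (Sg.freeForm.param σ))
    (G := fun _ => EnrichedFunctor.id V (S → V)) Sg.forget (fun A σ => strTo (A.op σ))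
    Sg.forget_map_powTensor_strTo
  -- Hom-objects of algebras are by definition those of the associated structured objects, so the
  -- morphism part of `L` serves unchanged.
  { obj := Alg.toFreeForm
    map := L.map
    map_id := L.map_id
    map_comp := L.map_comp }

/-- The `V`-functor from algebras for the free-form signature to algebras. -/
def ofFreeFormFunctor : EnrichedFunctor V Sg.freeForm.Alg Sg.Alg :=
  let L := StructuredObj.liftFunctor
    (F := fun σ => paramPowFunctor (Sg.param σ) (Sg.arity σ))
    (G := fun σ => projFunctor (Sg.out σ)) Sg.freeForm.forget (fun A σ => strOf (A.op σ))
    Sg.forget_map_paramPow_strOf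
  { obj := Alg.ofFreeForm
    map := L.map
    map_id := L.map_id
    map_comp := L.map_comp }

/-- The isomorphism between algebras and algebras for the free-form signature. -/
def isoFreeForm : IsoOver (V := V) Sg.forget Sg.freeForm.forget :=
  IsoOver.ofFaithful Sg.mono_forget_map (mono_freeFormSignature_forget_map Sg.freeForm)
    Sg.toFreeFormFunctor Sg.ofFreeFormFunctor
    (enrichedFunctor_ext rfl fun A B => heq_of_eq
      (StructuredObj.homLift_ι _ (Sg.forget_map_powTensor_strTo A B)))
    (enrichedFunctor_ext rfl fun A B => heq_of_eq
      (StructuredObj.homLift_ι _ (Sg.forget_map_paramPow_strOf A B)))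
    Alg.ofFreeForm_toFreeForm Alg.toFreeForm_ofFreeForm

end EnrichedSignature

/-! ### Contexts as arities -/

section Contexts

variable {S : Type w}

/-- The number of variables of each sort in a context. -/
def contextArity (Γ : Context S) : S →₀ ℕ :=
  Finsupp.ofSupportFinite (fun s => Nat.card {x : Γ // x.1.1 = s}) <| by
    classical
    -- Only the finitely many sorts that occur in `Γ` have a nonzero count.
    refine (Γ.image Sigma.fst).finite_toSet.subset fun s hs => ?_
    obtain ⟨⟨x, hx⟩⟩ := (Nat.card_ne_zero.1 hs).1
    exact Finset.mem_coe.2 (Finset.mem_image.2 ⟨x.1, x.2, hx⟩)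

/-- The numbering, sort by sort, of the variables of a context. -/
def contextEquiv (Γ : Context S) : Γ ≃ (Σ s, Fin (contextArity Γ s)) :=
  (Equiv.sigmaFiberEquiv fun x : Γ => x.1.1).symm.trans
    (Equiv.sigmaCongrRight fun s => Finite.equivFin {x : Γ // x.1.1 = s})

variable {V : Type v} [Category.{w} V] [HasLimits V]

/-- The isomorphism from a power of `X` to a product indexed by the variables of a context. -/
def contextIso (Γ : Context S) (X : S → V) :
    pow X (contextArity Γ) ≅ ∏ᶜ fun x : Γ => X x.1.1 :=
  (Pi.reindex (contextEquiv Γ) fun i => X i.1).symm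

theorem contextIso_hom_π (Γ : Context S) (X : S → V) (x : Γ) :
    (contextIso Γ X).hom ≫ Pi.π (fun x : Γ => X x.1.1) x =
      Pi.π (fun i : (Σ s, Fin (contextArity Γ s)) => X i.1) (contextEquiv Γ x) :=
  Pi.reindex_inv_π (contextEquiv Γ) (fun i => X i.1) x

theorem powMap_contextIso_hom (Γ : Context S) {X Y : S → V} (f : X ⟶ Y) :
    powMap f (contextArity Γ) ≫ (contextIso Γ Y).hom =
      (contextIso Γ X).hom ≫ Pi.lift fun x : Γ => Pi.π (fun x : Γ => X x.1.1) x ≫ f x.1.1 := by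
  refine Pi.hom_ext _ _ fun x => ?_
  rw [Category.assoc, contextIso_hom_π, Category.assoc, Pi.lift_π, ← Category.assoc,
    contextIso_hom_π]
  exact Pi.lift_π _ _

theorem powMap_contextIso_hom_comp {Γ : Context S} {X Y : S → V} (f : X ⟶ Y) {s : S}
    {a : (∏ᶜ fun x : Γ => X x.1.1) ⟶ X s} {b : (∏ᶜ fun x : Γ => Y x.1.1) ⟶ Y s}
    (h : (Pi.lift fun x : Γ => Pi.π (fun x : Γ => X x.1.1) x ≫ f x.1.1) ≫ b = a ≫ f s) :
    powMap f (contextArity Γ) ≫ (contextIso Γ Y).hom ≫ b =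
      ((contextIso Γ X).hom ≫ a) ≫ f s := by
  rw [← Category.assoc, powMap_contextIso_hom, Category.assoc, h, Category.assoc]

end Contexts

/-- Homomorphisms preserve derived operations: variables are projections, and an application
combines `hf` with the induction hypothesis for each argument. -/
theorem ClassicalSignature.Alg.interp_naturality {V : Type v} [Category.{w} V] [HasLimits V]
    {S : Type w} {Sg : ClassicalSignature S} {A B : Sg.Alg V} (f : A.carrier ⟶ B.carrier)
    (hf : ∀ σ, powMap f (Sg.arity σ) ≫ B.op σ = A.op σ ≫ f (Sg.out σ))
    {Γ : Context S} {s : S} (t : Sg.Term Γ s) :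
    (Pi.lift fun x : Γ => Pi.π (fun x : Γ => A.carrier x.1.1) x ≫ f x.1.1) ≫ B.interp t =
      A.interp t ≫ f s := by
  induction t with
  | var x => exact Pi.lift_π _ _
  | app σ t ih =>
    rw [interp, interp, Category.assoc, ← hf, ← Category.assoc, ← Category.assoc]
    refine congrArg (fun k => k ≫ B.op σ) (Pi.hom_ext _ _ fun i => ?_)
    rw [Category.assoc, Pi.lift_π, ih, Category.assoc, powMap, Pi.lift_π, ← Category.assoc,
      Pi.lift_π]

/-! ### Diagrammatic equations from syntactic equations -/

namespace EnrichedSignature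

variable {V : Type v} [Category.{w} V] [CartesianMonoidalCategory V]
  [HasLimits V] [HasColimits V] {S : Type w} {Sg : EnrichedSignature V S} {U : V ⥤ Type w}
  (hU : U.CorepresentableBy (𝟙_ V))

/-- Restricting the homomorphism square by `strOf` gives a square with parameter `P`; fixing `p : 1
⟶ P` commutes with `f^J`, which does not touch the parameter. -/
theorem Alg.underlying_op_naturality {A B : Sg.freeForm.Alg} (f : A.Hom B)
    (σ : (Sg.underlying U).Op) :
    powMap f.hom (Sg.arity σ.1) ≫ ((Alg.ofFreeForm B).underlying hU).op σ =
      ((Alg.ofFreeForm A).underlying hU).op σ ≫ f.hom (Sg.out σ.1) := by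
  have h : Sg.param σ.1 ◁ powMap f.hom (Sg.arity σ.1) ≫ strOf (B.op σ.1) =
      strOf (A.op σ.1) ≫ f.hom (Sg.out σ.1) :=
    (strOf_tensorMap _ _).symm.trans ((congrArg strOf (f.comm σ.1)).trans (strOf_comp _ _))
  have hp : powMap f.hom (Sg.arity σ.1) ≫
      lift (toUnit _ ≫ hU.homEquiv.symm σ.2) (𝟙 (pow B.carrier (Sg.arity σ.1))) =
      lift (toUnit _ ≫ hU.homEquiv.symm σ.2) (𝟙 (pow A.carrier (Sg.arity σ.1))) ≫
        Sg.param σ.1 ◁ powMap f.hom (Sg.arity σ.1) := by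
    refine CartesianMonoidalCategory.hom_ext _ _ ?_ ?_ <;> simp
  refine (Category.assoc _ _ _).symm.trans ((congrArg (fun k => k ≫ strOf (B.op σ.1)) hp).trans ?_)
  refine (Category.assoc _ _ _).trans ((congrArg (fun k => _ ≫ k) h).trans ?_)
  exact (Category.assoc _ _ _).symm

variable [MonoidalClosed V]

/-- The natural operation of a term in context. -/
def termOperation {Γ : Context S} {s : S} (t : (Sg.underlying U).Term Γ s) :
    Sg.freeForm.NaturalOperation (contextArity Γ) (single s (𝟙_ V)) where
  -- Since `1 × Y ≅ Y`, operations with parameter `single s 1` are the same as morphisms `A^J ⟶ A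
  -- s`; `snd` discards the unit factor.
  app A := strTo (snd (𝟙_ V) _ ≫ (contextIso Γ A.carrier).hom ≫
    ((Alg.ofFreeForm A).underlying hU).interp t)
  naturality {A B} f := by
    -- The naturality square in `V^S` need only be checked after restriction to the sort `s`.
    refine strOf_injective ?_
    rw [strOf_tensorMap, strOf_comp, strOf_strTo, strOf_strTo, whiskerLeft_snd_assoc,
      Category.assoc (snd _ _)]
    exact congrArg (fun k => _ ≫ k) (powMap_contextIso_hom_comp f.hom (ClassicalSignature.Alg.interp_naturality
      (A := (Alg.ofFreeForm A).underlying hU) (B := (Alg.ofFreeForm B).underlying hU) f.hom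
      (Alg.underlying_op_naturality hU f) t))

/-- The diagrammatic equation of a syntactic equation. -/
def diagrammaticEquation (e : (Sg.underlying U).Equation) : Sg.freeForm.DiagrammaticEquation where
  arity := contextArity e.ctx
  param := single e.sort (𝟙_ V)
  lhs := termOperation hU e.lhs
  rhs := termOperation hU e.rhs

/-- A term's interpretation is recovered from its natural operation: `strOf` undoes `strTo`, and the
unit projection and the renumbering of variables are isomorphisms. -/
theorem satisfies_diagrammaticEquation_iff (e : (Sg.underlying U).Equation)
    (A : Sg.freeForm.Alg) : A.Satisfies (diagrammaticEquation hU e) ↔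
      ((Alg.ofFreeForm A).underlying hU).Satisfies e := by
  constructor
  · intro h
    have h' := congrArg strOf h
    simp only [diagrammaticEquation, termOperation, strOf_strTo] at h'
    have : IsIso (snd (𝟙_ V) (pow A.carrier (contextArity e.ctx))) := by
      rw [← leftUnitor_hom]
      infer_instance
    exact (cancel_epi (contextIso e.ctx A.carrier).hom).1 ((cancel_epi _).1 h')
  · intro h
    exact congrArg (fun k => strTo (snd (𝟙_ V) _ ≫ (contextIso e.ctx A.carrier).hom ≫ k)) h

theorem satisfies_iff_toFreeForm (e : (Sg.underlying U).Equation) (A : Sg.Alg) :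
    (A.underlying hU).Satisfies e ↔ A.toFreeForm.Satisfies (diagrammaticEquation hU e) := by
  rw [satisfies_diagrammaticEquation_iff, Alg.ofFreeForm_toFreeForm]

end EnrichedSignature

/-- The diagrammatic presentation of an equational theory. -/
def EquationalTheory.presentation {V : Type v} [Category.{w} V] [CartesianMonoidalCategory V]
    [MonoidalClosed V] [HasLimits V] [HasColimits V] {U : V ⥤ Type w} {S : Type w}
    (T : EquationalTheory U S) (hU : U.CorepresentableBy (𝟙_ V)) :
    DiagrammaticPresentation V S where
  sig := T.sig.freeForm
  eqs := EnrichedSignature.diagrammaticEquation hU '' T.eqs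
  -- Diagrammatic equations quantify over all algebras, but these form the image of a set of
  -- syntactic equations, which live in `Type w`.
  small := inferInstance

/-- The isomorphism between the algebras for a theory and those for its presentation. -/
def EquationalTheory.isoPresentation {V : Type v} [Category.{w} V] [CartesianMonoidalCategory V]
    [MonoidalClosed V] [HasLimits V] [HasColimits V] {U : V ⥤ Type w} {S : Type w}
    (T : EquationalTheory U S) (hU : U.CorepresentableBy (𝟙_ V)) :
    IsoOver (V := V) (T.forget hU) (T.presentation hU).forget :=
  T.sig.isoFreeForm.fullSub T.sig.mono_forget_map
    (EnrichedSignature.mono_freeFormSignature_forget_map T.sig.freeForm) fun A => by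
      refine Iff.trans ?_ Set.forall_mem_image.symm
      exact forall₂_congr fun e _ => EnrichedSignature.satisfies_iff_toFreeForm hU e A

end MultiSorted

end

theorem mainTheorem6 {V : Type v} [Category.{w} V] [HasLimits V] [HasColimits V]
    [CartesianMonoidalCategory V] [MonoidalClosed V]
    (U : V ⥤ Type w) [U.Faithful] (hU : U.CorepresentableBy (𝟙_ V)) (S : Type w) :
    (∀ Sg : MultiSorted.EnrichedSignature V S,
      ∃ (Fr : MultiSorted.FreeFormSignature V S)
        (Φ : MultiSorted.IsoOver (V := V) Sg.forget Fr.forget),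
        ∀ e : (Sg.underlying U).Equation, ∃ d : Fr.DiagrammaticEquation,
          ∀ A : Sg.Alg, (A.underlying hU).Satisfies e ↔ (Φ.functor.obj A).Satisfies d) ∧
    (∀ T : MultiSorted.EquationalTheory U S, ∃ P : MultiSorted.DiagrammaticPresentation V S,
      Nonempty (MultiSorted.IsoOver (V := V) (T.forget hU) P.forget)) := by
  refine ⟨fun Sg => ⟨Sg.freeForm, Sg.isoFreeForm, fun e => ?_⟩, fun T => ⟨T.presentation hU, ?_⟩⟩
  -- The functor of `isoFreeForm` sends `A` to `A.toFreeForm` by definition.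
  · exact ⟨MultiSorted.EnrichedSignature.diagrammaticEquation hU e, fun A =>
      MultiSorted.EnrichedSignature.satisfies_iff_toFreeForm hU e A⟩
  · exact ⟨T.isoPresentation hU⟩
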